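/- Let $p$ be a prime, $h\ge 1$, $q=p^h$. For $r\ge 1$ let $E_{p^{hr}}$ be the elementary abelian group of order $p^{hr}$, identified with the additive group of $\mathbb F_q^{\,r}$ by some group isomorphism. Given $a_1,\dots,a_n\in E_{p^{hr}}$, a nonempty $I\subseteq\{1,\dots,n\}$ is a weighted zero-sum subsequence if there are nonzero scalars $x_i\in\mathbb F_q$ $(i\in I)$ with $\sum_{i\in I}x_i a_i=0$. Let $D_2^h(E_{p^{hr}})$ be the smallest integer $\ell$ such that every sequence of $\ell$ elements of $E_{p^{hr}}$ has two disjoint weighted zero-sum subsequences. (The statement is asserted for every choice of the isomorphisms.) Then $$\limsup_{r\to\infty}\frac{D_2^h(E_{p^{hr}})}{r}\le 2-\frac1{p^h}.$$ Moreover, suppose $q=p^h\le 17$. Put $H_q(y)=-y\log_q\frac{y}{q-1}-(1-y)\log_q(1-y)$, extended by continuity to $[0,1]$, and $$M_q(x)=H_q\!\left(\tfrac1q\left(q-1-(q-2)x-2\sqrt{(q-1)x(1-x)}\right)\right).$$ Then the equation $M_q(x)=x$ has exactly one solution $R_q$ in the open interval $(0,1-\frac1q)$, and $$\limsup_{r\to\infty}\frac{D_2^h(E_{p^{hr}})}{r}\le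 \frac1{1-R_q}\le B_q<2-\frac1q ,\qquad \frac1{1-R_q}>B_q-10^{-4},$$ where $B_q$ (that is, $\frac1{1-R_q}$ rounded up to four decimals) is given by $$\begin{array}{c|ccccccccccc} q&2&3&4&5&7&8&9&11&13&16&17\\\hline B_q&1.3957&1.5473&1.6365&1.6974&1.7774&1.8056&1.8291&1.8660&1.8941&1.9258&1.9344\end{array}$$ -/

import Mathlib

open Filter

/-- The index set `I` selects a `W`-weighted zero-sum subsequence of the sequence `a`: it is
nonempty, and for suitable weights `ε i ∈ W` the sum of the `ε i (a i)` over `i ∈ I` is zero. -/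
def IsWeightedZeroSum {G : Type*} [AddCommGroup G] (W : Set (AddMonoid.End G)) {n : ℕ}
    (a : Fin n → G) (I : Finset (Fin n)) : Prop :=
  I.Nonempty ∧ ∃ ε : Fin n → AddMonoid.End G, (∀ i ∈ I, ε i ∈ W) ∧ ∑ i ∈ I, ε i (a i) = 0

/-- The sequence `a` has `j` disjoint `W`-weighted zero-sum subsequences. -/
def HasDisjointZeroSums {G : Type*} [AddCommGroup G] (W : Set (AddMonoid.End G)) (j : ℕ) {n : ℕ}
    (a : Fin n → G) : Prop :=
  ∃ I : Fin j → Finset (Fin n),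
    (∀ s, IsWeightedZeroSum W a (I s)) ∧ ∀ s t, s ≠ t → Disjoint (I s) (I t)

/-- The `j`-wise `W`-weighted Davenport constant of `G`: the smallest `ℓ` such that every sequence
of `ℓ` elements of `G` has `j` disjoint `W`-weighted zero-sum subsequences. -/
noncomputable def davenport (G : Type*) [AddCommGroup G] (W : Set (AddMonoid.End G)) (j : ℕ) : ℕ :=
  sInf {ℓ : ℕ | ∀ a : Fin ℓ → G, HasDisjointZeroSums W j a}

/-- The endomorphism `y ↦ φ⁻¹ (x • φ y)` of `G`. -/
def scalarWeight {G V F : Type*} [AddCommGroup G] [AddCommGroup V] [Field F] [Module F V]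
    (φ : G ≃+ V) (x : F) : AddMonoid.End G where
  toFun y := φ.symm (x • φ y)
  map_zero' := by simp
  map_add' y z := by simp

theorem scalarWeight_apply {G V F : Type*} [AddCommGroup G] [AddCommGroup V] [Field F]
    [Module F V] (φ : G ≃+ V) (x : F) (y : G) : scalarWeight φ x y = φ.symm (x • φ y) := rfl

/-- The set of weights on `G` induced, through `φ`, by multiplication by the nonzero scalars
of `F`. -/
def scalarWeights {G V : Type*} (F : Type*) [AddCommGroup G] [AddCommGroup V] [Field F]
    [Module F V] (φ : G ≃+ V) : Set (AddMonoid.End G) :=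
  {m | ∃ x : F, x ≠ 0 ∧ m = scalarWeight φ x}

/-- The elementary abelian group of order `p ^ n`. -/
abbrev ElemAbelian (p n : ℕ) : Type := Fin n → ZMod p

/-- The constant `D_j^h(E_{p^{hr}})`, where `φ` identifies `E_{p^{hr}}` with `F ^ r` for the
field `F` with `p ^ h` elements. -/
noncomputable def scalarDavenport {p h r : ℕ} {F : Type*} [Field F]
    (φ : ElemAbelian p (h * r) ≃+ (Fin r → F)) (j : ℕ) : ℕ :=
  davenport (ElemAbelian p (h * r)) (scalarWeights F φ) j

/-- The set whose infimum defines the constant is nonempty, so the infimum is a minimum. -/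
theorem scalarDavenport_isLeast {p h r : ℕ} {F : Type*} [Field F]
    (φ : ElemAbelian p (h * r) ≃+ (Fin r → F)) (j : ℕ) :
    IsLeast {ℓ : ℕ | ∀ a : Fin ℓ → ElemAbelian p (h * r),
      HasDisjointZeroSums (scalarWeights F φ) j a} (scalarDavenport φ j) := by
  classical
  have hne : {ℓ : ℕ | ∀ a : Fin ℓ → ElemAbelian p (h * r),
      HasDisjointZeroSums (scalarWeights F φ) j a}.Nonempty := by
    refine ⟨j * (r + 1), fun a => ?_⟩
    have key : ∀ s : Fin j, ∃ g : Fin (r + 1) → F,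
        ∑ i, g i • φ (a (finProdFinEquiv (s, i))) = 0 ∧ ∃ i, g i ≠ 0 := by
      intro s
      rw [← Fintype.not_linearIndependent_iff]
      intro hl
      have := hl.fintype_card_le_finrank
      simp at this
    choose g hg i hi using key
    have inj : ∀ s : Fin j, Function.Injective
        (fun i : Fin (r + 1) => finProdFinEquiv (s, i)) := fun s x y hxy => by
      simpa using hxy
    refine ⟨fun s => (Finset.univ.filter fun i => g s i ≠ 0).image
      fun i => finProdFinEquiv (s, i), fun s => ⟨?_, ?_⟩, ?_⟩
    · exact ⟨finProdFinEquiv (s, i s), Finset.mem_image.2 ⟨i s, by simp [hi], rfl⟩⟩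
    · refine ⟨fun t => scalarWeight φ (g s (finProdFinEquiv.symm t).2), ?_, ?_⟩
      · intro t ht
        obtain ⟨x, hx, rfl⟩ := Finset.mem_image.1 ht
        exact ⟨g s x, by simpa using hx, by simp only [Equiv.symm_apply_apply]⟩
      · rw [Finset.sum_image (fun x _ y _ hxy => inj s hxy)]
        apply φ.injective
        rw [map_sum, map_zero, ← hg s, Finset.sum_filter]
        refine Finset.sum_congr rfl fun x _ => ?_
        simp only [Equiv.symm_apply_apply]
        by_cases hx : g s x = 0 <;> simp [hx, scalarWeight_apply]
    · intro s t hst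
      rw [Finset.disjoint_left]
      intro x hx hy
      obtain ⟨u, _, rfl⟩ := Finset.mem_image.1 hx
      obtain ⟨v, _, hv⟩ := Finset.mem_image.1 hy
      exact hst (congrArg Prod.fst (finProdFinEquiv.injective hv)).symm
  exact ⟨Nat.sInf_mem hne, fun _ hm => Nat.sInf_le hm⟩

/-- An identification of `E_{p^{hr}}` with `F ^ r` exists. -/
theorem nonempty_elemAbelian_addEquiv {p h : ℕ} (hp : p.Prime) {F : Type*} [Field F]
    (hF : Nat.card F = p ^ h) (r : ℕ) :
    Nonempty (ElemAbelian p (h * r) ≃+ (Fin r → F)) := by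
  have : Fact p.Prime := ⟨hp⟩
  have : Finite F := Nat.finite_of_card_ne_zero (by rw [hF]; exact (pow_pos hp.pos h).ne')
  let _ : Fintype F := Fintype.ofFinite F
  have hh : h ≠ 0 := by
    rintro rfl
    have := Finite.one_lt_card (α := F)
    rw [hF, pow_zero] at this
    exact lt_irrefl _ this
  have : CharP F p := charP_of_card_eq_prime_pow (f := h) (by rw [← hF, Nat.card_eq_fintype_card])
  let : Algebra (ZMod p) F := ZMod.algebra F p
  have h1 : Module.finrank (ZMod p) F = h := by
    have := Module.natCard_eq_pow_finrank (K := ZMod p) (V := F)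
    rw [hF, Nat.card_zmod] at this
    exact (Nat.pow_right_injective hp.two_le this).symm
  refine ⟨(LinearEquiv.ofFinrankEq (R := ZMod p) (ElemAbelian p (h * r)) (Fin r → F)
    ?_).toAddEquiv⟩
  rw [Module.finrank_pi_fintype, Module.finrank_pi_fintype]
  simp [h1, mul_comm]

/-- The function `M_q(x) = H_q((q - 1 - (q - 2) x - 2 √((q - 1) x (1 - x))) / q)`, where
`H_q(y) = -y log_q (y / (q - 1)) - (1 - y) log_q (1 - y)` is the entropy to base `q`
(`Real.qaryEntropy` uses the natural logarithm). -/
noncomputable def mrrw (q : ℕ) (x : ℝ) : ℝ :=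
  Real.qaryEntropy q (((q : ℝ) - 1 - ((q : ℝ) - 2) * x
    - 2 * Real.sqrt (((q : ℝ) - 1) * x * (1 - x))) / q) / Real.log q

/-- The table of numerical bounds for the prime powers `q ≤ 17`, rounded up to four decimals. -/
noncomputable def tableBound : ℕ → ℝ
  | 2 => 1.3957
  | 3 => 1.5473
  | 4 => 1.6365
  | 5 => 1.6974
  | 7 => 1.7774
  | 8 => 1.8056
  | 9 => 1.8291
  | 11 => 1.8660
  | 13 => 1.8941
  | 16 => 1.9258
  | 17 => 1.9344
  | _ => 0

/-!
A sequence `a₁, …, aₙ` in `F ^ r` defines the linear code `C = {e ∈ F ^ n | ∑ eᵢ aᵢ = 0}`, of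
dimension `k ≥ n - r`. The weighted zero-sum subsequences are the supports of the nonzero words
of `C`, so the sequence has no two disjoint ones exactly when any two nonzero words of `C` have
intersecting supports (`Submodule.IsIntersecting`). In that case restriction of `C` to the support
of a nonzero word is injective, whence the minimum distance is at least `k`. An asymptotic bound
`k ≤ θ n` for such codes gives `n (1 - θ) ≤ r`, and hence `limsup D₂ / r ≤ 1 / (1 - θ)`.

Both bounds on `k` come from one inequality, valid for a linear code of length `n` and minimum
distance at least `d`, with `q = |F|` (`card_le_of_le_lineSum`): if `f ≥ 0` is a nonzero function
on `F ^ n` for which the operator `lineSum`, which adds up the values on the Hamming ball of radius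
one with the centre counted `n` times, satisfies `lineSum f ≥ l f` with `l ≥ q (n - d) + 1`, then
`|C| ≤ q d |supp f|`. To see this, push `f` forward along `e ↦ ∑ eᵢ gᵢ` to the dual space of `C`,
where `gᵢ` is the `i`-th coordinate functional. There the operator becomes a Cayley graph operator
whose eigenvalue at the character given by `c ∈ C` is `q (n - wt c)`, so all eigenvalues but the
trivial one are at most `q (n - d)` (`sum_mul_sum_translate_le`), and the constant component of
the push-forward has to be large; by Cauchy–Schwarz so has its support. There are two choices
of `f`.

* For the indicator function of a coordinate subspace the inequality is the Plotkin bound; with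
  `d ≥ k` it gives every `θ > (q - 1) / (2 q - 1)`, and `1 / (1 - θ)` tends to `2 - 1 / q`.
* For a function of the weight supported on a window of bounded length below `x n`
  (`windowProfile`), `l / n` is close to `1 + (q - 2) x + 2 √((q - 1) x (1 - x))` and the support
  has at most `exp (n H x)` elements, where `H` is the entropy. This is the first linear
  programming bound; with `d ≥ k` it gives every `θ > R`, where `R` is the fixed point of `mrrw`.

The argument `μ` of the entropy in `mrrw` is a decreasing involution of `[0, 1 - 1 / q]`
(`mrrwArg_strictAntiOn`, `mrrwArg_mrrwArg`), because `√(μ x) = sin (α - β)` when `√x = sin β` and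
`√(1 - 1 / q) = sin α`. So `mrrw` decreases strictly, and has exactly one fixed point. Moreover, if
for some `y` the numbers `μ y` and `H y / log q` both lie in an interval, then so does `R`; the
table is verified by exhibiting such a rational number `y` for each `q`.
-/

/-! ### The spectral inequality on the dual of a code -/

section Spectral

open Finset

variable {F : Type*} [Field F] {M : Type*} [AddCommGroup M] [Module F M] [Fintype M]

theorem exists_addChar_isPrimitive (F : Type*) [Field F] [Finite F] :
    ∃ ψ : AddChar F ℂ, ψ.IsPrimitive := by
  obtain ⟨ψ, hψ⟩ := AddChar.exists_apply_ne_zero.2 (one_ne_zero (α := F))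
  exact ⟨ψ, AddChar.IsPrimitive.of_ne_one fun h => hψ (by simp [h])⟩

/-- Orthogonality of the characters `c ↦ ψ (v c)` of `M`, for `v` in the dual space. -/
theorem sum_addChar_dual [DecidableEq (Module.Dual F M)] {ψ : AddChar F ℂ}
    (hψ : ψ.IsPrimitive) (v : Module.Dual F M) :
    ∑ c : M, ψ (v c) = if v = 0 then (Fintype.card M : ℂ) else 0 := by
  split_ifs with h
  · simp [h]
  · obtain ⟨c, hc⟩ : ∃ c, v c ≠ 0 := by
      by_contra! h'
      exact h (LinearMap.ext h')
    have : ψ.compAddMonoidHom v.toAddMonoidHom ≠ 1 := by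
      intro h1
      refine hψ hc ?_
      ext x
      have := DFunLike.congr_fun h1 (x • c)
      simpa [AddChar.mulShift_apply, mul_comm] using this
    exact AddChar.sum_eq_zero_of_ne_one this

/-- The spectral inequality for the Cayley graph of the dual space of `M` generated by the
multiples of the functionals `g i`. The eigenvalue at the character `v ↦ ψ (v c)` is
`|F|` times the number of `i` with `g i c = 0`. -/
theorem sum_mul_sum_translate_le [Fintype F] [Fintype (Module.Dual F M)] {ι : Type*} [Fintype ι]
    [DecidableEq F] (g : ι → Module.Dual F M) (d : ℕ)
    (hd : ∀ c : M, c ≠ 0 → d ≤ #{i | g i c ≠ 0}) (G : Module.Dual F M → ℝ) :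
    ∑ v, G v * ∑ i, ∑ a : F, G (v + a • g i) ≤
      Fintype.card F * ((Fintype.card ι : ℝ) - d) * ∑ v, G v ^ 2 +
        Fintype.card F * d * (∑ v, G v) ^ 2 / Fintype.card M := by
  classical
  obtain ⟨ψ, hψ⟩ := exists_addChar_isPrimitive F
  have hconj : ∀ x, (starRingEnd ℂ) (ψ x) = ψ (-x) := fun x => by
    rw [AddChar.starComp_apply, AddChar.inv_apply]
    exact (CharP.char_is_prime F (ringChar F)).pos
  -- the squared absolute values of the Fourier coefficients of `G`
  set N : M → ℝ := fun c => Complex.normSq (∑ v, (G v : ℂ) * ψ (v c)) with hN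
  have hN0 : ∀ c, 0 ≤ N c := fun c => Complex.normSq_nonneg _
  -- autocorrelation of `G` is the Fourier transform of `N`
  have hcor : ∀ w : Module.Dual F M, ∑ c, (N c : ℂ) * ψ (w c) =
      Fintype.card M * ∑ v, (G v : ℂ) * G (v + w) := by
    intro w
    have h1 : ∀ c, (N c : ℂ) * ψ (w c) =
        ∑ v, ∑ v', (G v : ℂ) * G v' * ψ ((v - v' + w) c) := by
      intro c
      rw [hN, ← Complex.mul_conj, map_sum, Finset.sum_mul_sum, Finset.sum_mul]
      refine sum_congr rfl fun v _ => ?_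
      rw [Finset.sum_mul]
      refine sum_congr rfl fun v' _ => ?_
      rw [map_mul, hconj, Complex.conj_ofReal, LinearMap.add_apply, LinearMap.sub_apply,
        AddChar.map_add_eq_mul, sub_eq_add_neg, AddChar.map_add_eq_mul]
      ring
    simp_rw [h1]
    rw [sum_comm, mul_sum]
    refine sum_congr rfl fun v _ => ?_
    rw [sum_comm]
    simp_rw [← mul_sum, sum_addChar_dual hψ]
    rw [sum_eq_single (v + w)]
    · simp; ring
    · intro b _ hb
      rw [if_neg, mul_zero]
      intro h0
      exact hb (by rw [← sub_eq_zero, ← neg_eq_zero, ← h0]; abel)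
    · simp
  have hcard : (0 : ℝ) < Fintype.card M := by exact_mod_cast Fintype.card_pos
  have hN00 : N 0 = (∑ v, G v) ^ 2 := by
    simp only [hN, map_zero, AddChar.map_zero_eq_one, mul_one]
    rw [← Complex.ofReal_sum, Complex.normSq_ofReal, sq]
  have hpars : ∑ c, N c = Fintype.card M * ∑ v, G v ^ 2 := by
    have := hcor 0
    simp only [LinearMap.zero_apply, AddChar.map_zero_eq_one, mul_one, add_zero] at this
    simp_rw [sq]
    exact_mod_cast this
  have hmain : ∑ c, N c * (Fintype.card F * ((Fintype.card ι : ℝ) - #{i | g i c ≠ 0})) =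
      Fintype.card M * ∑ v, G v * ∑ i, ∑ a : F, G (v + a • g i) := by
    have h2 : ∀ c, ∑ i, ∑ a : F, ψ ((a • g i) c) =
        ((Fintype.card F * ((Fintype.card ι : ℝ) - #{i | g i c ≠ 0}) : ℝ) : ℂ) := by
      intro c
      have h3 : ∀ i, ∑ a : F, ψ ((a • g i) c) =
          (Fintype.card F : ℂ) * (1 - if g i c ≠ 0 then 1 else 0) := by
        intro i
        simp only [LinearMap.smul_apply, smul_eq_mul]
        rw [AddChar.sum_mulShift _ hψ]
        by_cases h : g i c = 0 <;> simp [h]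
      simp_rw [h3]
      rw [← mul_sum, sum_sub_distrib, sum_boole]
      simp
    have h4 : ((∑ c, N c * (Fintype.card F * ((Fintype.card ι : ℝ) - #{i | g i c ≠ 0})) : ℝ) : ℂ)
        = ((Fintype.card M * ∑ v, G v * ∑ i, ∑ a : F, G (v + a • g i) : ℝ) : ℂ) := by
      rw [Complex.ofReal_sum]
      simp_rw [Complex.ofReal_mul (N _), ← h2, mul_sum]
      rw [sum_comm]
      simp_rw [sum_comm (s := (univ : Finset M)) (t := (univ : Finset F)), hcor]
      push_cast
      simp_rw [mul_sum]
      rw [sum_comm (s := (univ : Finset (Module.Dual F M)))]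
      refine sum_congr rfl fun i _ => ?_
      rw [sum_comm]
    exact_mod_cast h4
  -- only the trivial character, at `c = 0`, may exceed the bound `|F| * (|ι| - d)`
  have hle : ∑ c, N c * (Fintype.card F * ((Fintype.card ι : ℝ) - #{i | g i c ≠ 0})) ≤
      ∑ c, (N c * (Fintype.card F * ((Fintype.card ι : ℝ) - d)) +
        if c = 0 then N c * (Fintype.card F * d) else 0) := by
    refine sum_le_sum fun c _ => ?_
    split_ifs with h
    · subst h; simp; linarith
    · rw [add_zero]
      have := hd c h
      gcongr
      exact hN0 c
  rw [hmain, sum_add_distrib, ← sum_mul, hpars, sum_ite_eq' , if_pos (mem_univ _), hN00] at hle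
  rw [← mul_le_mul_iff_right₀ hcard]
  refine hle.trans_eq ?_
  field_simp

end Spectral

/-! ### From test functions to bounds for codes -/

section TestFunction

open Finset

variable {F : Type*} [Field F] [Fintype F] [DecidableEq F] {M : Type*} [AddCommGroup M]
  [Module F M] [Fintype M] {ι : Type*} [Fintype ι] [DecidableEq ι]

/-- The sum of the values of `f` on the lines through `e` parallel to the coordinate axes. The
point `e` lies on each of these lines, so that `f e` is counted `|ι|` times; this shifts the
adjacency operator of the Hamming graph by `|ι|`. -/
def lineSum (f : (ι → F) → ℝ) (e : ι → F) : ℝ :=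
  ∑ i, ∑ a : F, f (Function.update e i a)

/-- If a nonnegative test function on `F ^ ι` is a super-eigenfunction of `lineSum` for a value
above every nontrivial eigenvalue of a code of minimum distance at least `d`, then the size of
its support bounds the size of the code. The code is presented by its coordinate functionals
`g`. -/
theorem card_le_of_le_lineSum (g : ι → Module.Dual F M) (d : ℕ)
    (hd : ∀ c : M, c ≠ 0 → d ≤ #{i | g i c ≠ 0}) (f : (ι → F) → ℝ) (hf : ∀ e, 0 ≤ f e)
    (hne : ∃ e, f e ≠ 0) (l : ℝ)
    (hl : Fintype.card F * ((Fintype.card ι : ℝ) - d) + 1 ≤ l)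
    (hfl : ∀ e, l * f e ≤ lineSum f e) (S : Finset (ι → F)) (hS : ∀ e, f e ≠ 0 → e ∈ S) :
    (Fintype.card M : ℝ) ≤ Fintype.card F * d * #S := by
  classical
  have : Finite (Module.Dual F M) := Finite.of_injective (fun v : Module.Dual F M => (v : M → F))
    DFunLike.coe_injective
  let _ : Fintype (Module.Dual F M) := Fintype.ofFinite _
  -- the push-forward of `f` along `e ↦ ∑ i, e i • g i`
  let P : (ι → F) → Module.Dual F M := fun e => ∑ i, e i • g i
  let G : Module.Dual F M → ℝ := fun v => ∑ e with P e = v, f e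
  have hG0 : ∀ v, 0 ≤ G v := fun v => sum_nonneg fun e _ => hf e
  have hGsum : ∑ v, G v = ∑ e, f e := sum_fiberwise _ _ _
  have hP : ∀ e i (b : F), P (e + Pi.single i b) = P e + b • g i := by
    intro e i b
    simp only [P, Pi.add_apply, add_smul, sum_add_distrib]
    congr 1
    rw [sum_eq_single i] <;> simp +contextual
  have hA : ∀ e, lineSum f e = ∑ i, ∑ b : F, f (e + Pi.single i b) := by
    intro e
    refine sum_congr rfl fun i _ => ?_
    refine (Fintype.sum_equiv (Equiv.addLeft (e i)) _ _ fun b => ?_).symm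
    congr 1
    ext j
    by_cases h : j = i
    · subst h; simp
    · simp [h]
  have hGl : ∀ v, l * G v ≤ ∑ i, ∑ b : F, G (v + b • g i) := by
    intro v
    have h1 : ∀ i (b : F), G (v + b • g i) = ∑ e with P e = v, f (e + Pi.single i b) := by
      intro i b
      refine (sum_bij (fun e _ => e + Pi.single i b) ?_ ?_ ?_ ?_).symm
      · intro e he
        simp only [mem_filter, mem_univ, true_and] at he ⊢
        rw [hP, he]
      · intro e _ e' _ h
        exact add_right_cancel h
      · intro e he
        refine ⟨e - Pi.single i b, ?_, by simp⟩
        simp only [mem_filter, mem_univ, true_and] at he ⊢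
        have := hP (e - Pi.single i b) i b
        rw [sub_add_cancel, he] at this
        exact (add_right_cancel this).symm
      · intros; rfl
    simp_rw [h1]
    rw [mul_sum]
    refine (sum_le_sum fun e _ => (hfl e).trans_eq (hA e)).trans_eq ?_
    rw [sum_comm]
    refine sum_congr rfl fun i _ => sum_comm
  have hspec := sum_mul_sum_translate_le g d hd G
  have h2 : l * ∑ v, G v ^ 2 ≤ ∑ v, G v * ∑ i, ∑ a : F, G (v + a • g i) := by
    rw [mul_sum]
    refine sum_le_sum fun v _ => ?_
    have := mul_le_mul_of_nonneg_left (hGl v) (hG0 v)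
    linarith
  -- Cauchy–Schwarz on the support of `G`, which is contained in the image of `S`
  have hcs : (∑ v, G v) ^ 2 ≤ #S * ∑ v, G v ^ 2 := by
    have h3 : ∑ v, G v = ∑ v ∈ S.image P, G v := by
      refine (sum_subset (subset_univ _) fun v _ hv => ?_).symm
      refine sum_eq_zero fun e he => ?_
      by_contra h
      exact hv (mem_image.2 ⟨e, hS e h, (mem_filter.1 he).2⟩)
    rw [h3]
    refine (sq_sum_le_card_mul_sum_sq).trans ?_
    gcongr
    · exact card_image_le
    · exact subset_univ _
  have hpos : 0 < ∑ v, G v := by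
    rw [hGsum]
    obtain ⟨e, he⟩ := hne
    exact sum_pos' (fun e _ => hf e) ⟨e, mem_univ _, lt_of_le_of_ne (hf e) he.symm⟩
  have hG2 : 0 < ∑ v, G v ^ 2 := by
    by_contra! h
    have h0 : (∑ v, G v) ^ 2 ≤ 0 :=
      hcs.trans (mul_nonpos_of_nonneg_of_nonpos (Nat.cast_nonneg _) h)
    exact absurd h0 (not_le.2 (by positivity))
  have hM : (0 : ℝ) < Fintype.card M := by exact_mod_cast Fintype.card_pos
  have h4 : ∑ v, G v ^ 2 ≤ Fintype.card F * d * (∑ v, G v) ^ 2 / Fintype.card M := by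
    have := mul_le_mul_of_nonneg_right hl hG2.le
    linarith
  rw [le_div_iff₀ hM] at h4
  have h5 : (Fintype.card F * d : ℝ) * (∑ v, G v) ^ 2 ≤
      Fintype.card F * d * (#S * ∑ v, G v ^ 2) := by gcongr
  refine le_of_mul_le_mul_left ?_ hG2
  linarith

/-- The operator `lineSum` on functions of the Hamming weight. At weight zero the truncated
predecessor `hammingNorm e - 1` is harmless, since its coefficient vanishes. -/
theorem lineSum_hammingNorm (t : ℕ → ℝ) (e : ι → F) :
    lineSum (fun e => t (hammingNorm e)) e =
      hammingNorm e * ((Fintype.card F - 1) * t (hammingNorm e) + t (hammingNorm e - 1)) +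
      ((Fintype.card ι : ℝ) - hammingNorm e) *
        (t (hammingNorm e) + (Fintype.card F - 1) * t (hammingNorm e + 1)) := by
  -- the weight of `update e i a`, written without subtraction
  have hupd : ∀ i (a : F), hammingNorm (Function.update e i a) + (if e i ≠ 0 then 1 else 0) =
      hammingNorm e + if a ≠ 0 then 1 else 0 := by
    intro i a
    simp only [hammingNorm, card_filter]
    rw [← add_sum_erase _ _ (mem_univ i), ← add_sum_erase univ (fun j => if e j ≠ 0 then 1 else 0)
      (mem_univ i)]
    have : ∑ j ∈ univ.erase i, (if Function.update e i a j ≠ 0 then 1 else 0) =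
        ∑ j ∈ univ.erase i, (if e j ≠ 0 then 1 else 0) :=
      sum_congr rfl fun j hj => by rw [Function.update_of_ne (ne_of_mem_erase hj)]
    rw [this, Function.update_self]
    ring
  have hq : ((univ.erase (0 : F)).card : ℝ) = Fintype.card F - 1 := by
    rw [card_erase_of_mem (mem_univ _), card_univ, Nat.cast_sub Fintype.card_pos]
    simp
  have hi : ∀ i, ∑ a : F, t (hammingNorm (Function.update e i a)) =
      if e i ≠ 0 then (Fintype.card F - 1) * t (hammingNorm e) + t (hammingNorm e - 1)
      else t (hammingNorm e) + (Fintype.card F - 1) * t (hammingNorm e + 1) := by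
    intro i
    rw [← add_sum_erase _ _ (mem_univ (0 : F))]
    have h0 := hupd i 0
    have h1 : ∀ c : ℝ, (∀ a : F, a ≠ 0 → t (hammingNorm (Function.update e i a)) = c) →
        ∑ a ∈ univ.erase (0 : F), t (hammingNorm (Function.update e i a)) =
          (Fintype.card F - 1) * c := by
      intro c hc
      rw [sum_congr rfl fun a ha => hc a (ne_of_mem_erase ha), sum_const, nsmul_eq_mul, hq]
    split_ifs with h
    · rw [h1 (t (hammingNorm e)), add_comm]
      · congr 2
        simp [h] at h0; omega
      · intro a ha
        have := hupd i a
        simp [h, ha] at this; rw [this]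
    · rw [h1 (t (hammingNorm e + 1))]
      · congr 2
        simp [h] at h0; omega
      · intro a ha
        have := hupd i a
        simp [h, ha] at this; rw [this]
  have hcard : (#{i | ¬ e i ≠ 0} : ℝ) = Fintype.card ι - hammingNorm e := by
    rw [hammingNorm, eq_sub_iff_add_eq, ← card_univ (α := ι),
      ← card_filter_add_card_filter_not (s := univ) (fun i => e i ≠ 0)]
    push_cast
    ring
  rw [lineSum]
  simp_rw [hi]
  rw [sum_ite, sum_const, sum_const, nsmul_eq_mul, nsmul_eq_mul, hcard]
  rfl

end TestFunction

/-! ### Two families of test functions, and the size of their supports -/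

section Windows

open Finset

variable {F : Type*} [Field F] [Fintype F] [DecidableEq F] {ι : Type*} [Fintype ι] [DecidableEq ι]

/-- The function `w ↦ c ^ w (w - s) (s + m - w)` of the weight, cut off outside the window
`s < w < s + m`. -/
noncomputable def windowProfile (s m : ℕ) (c : ℝ) (w : ℕ) : ℝ :=
  c ^ w * max 0 (((w : ℝ) - s) * (s + m - w))

theorem windowProfile_nonneg (s m : ℕ) {c : ℝ} (hc : 0 < c) (w : ℕ) :
    0 ≤ windowProfile s m c w :=
  mul_nonneg (pow_pos hc w).le (le_max_left _ _)

theorem windowProfile_ne_zero_iff (s m : ℕ) {c : ℝ} (hc : 0 < c) (w : ℕ) :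
    windowProfile s m c w ≠ 0 ↔ s < w ∧ w < s + m := by
  rw [windowProfile, mul_ne_zero_iff, and_iff_right (pow_pos hc w).ne', Ne, max_eq_left_iff, not_le]
  constructor
  · intro h
    rcases pos_and_pos_or_neg_and_neg_of_mul_pos h with ⟨h1, h2⟩ | ⟨h1, h2⟩
    · exact ⟨by exact_mod_cast sub_pos.1 h1, by exact_mod_cast sub_pos.1 h2⟩
    · have h3 : (w : ℝ) < s := sub_neg.1 h1
      have h4 : (s : ℝ) + m < w := sub_neg.1 h2
      have : (0 : ℝ) ≤ m := Nat.cast_nonneg m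
      linarith
  · rintro ⟨h1, h2⟩
    have h3 : (s : ℝ) < w := by exact_mod_cast h1
    have h4 : (w : ℝ) < s + m := by exact_mod_cast h2
    exact mul_pos (by linarith) (by linarith)

/-- The factor `c ^ w` balances the weights `w` and `(n - w) (q - 1)` of the neighbours of smaller
and larger weight, both of which become at least `K`; the remaining second difference of the
concave parabola `j (m - j)` is `-2`, which costs only the factor `1 - 1 / (m - 1)`. -/
theorem le_lineSum_windowProfile (s m : ℕ) (hm : 2 ≤ m) {c : ℝ} (hc : 0 < c) {K : ℝ} (hK : 0 ≤ K)
    (h1 : K ≤ s / c) (h2 : K ≤ ((Fintype.card ι : ℝ) - s - m) * (Fintype.card F - 1) * c)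
    (e : ι → F) :
    ((Fintype.card ι : ℝ) + (Fintype.card F - 2) * s + (2 - 2 / ((m : ℝ) - 1)) * K) *
        windowProfile s m c (hammingNorm e) ≤
      lineSum (fun e : ι → F => windowProfile s m c (hammingNorm e)) e := by
  have hq : (2 : ℝ) ≤ Fintype.card F := by exact_mod_cast Fintype.one_lt_card (α := F)
  have hw : (hammingNorm e : ℝ) ≤ Fintype.card ι := by exact_mod_cast hammingNorm_le_card_fintype
  rw [lineSum_hammingNorm]
  set w := hammingNorm e
  set n : ℝ := (Fintype.card ι : ℝ)
  set q : ℝ := (Fintype.card F : ℝ)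
  have hnn := windowProfile_nonneg s m hc
  by_cases h0 : windowProfile s m c w = 0
  · rw [h0]
    have := hnn (w - 1)
    have := hnn (w + 1)
    have : 0 ≤ n - w := by linarith
    have : 0 ≤ q - 1 := by linarith
    simp only [mul_zero, zero_add]
    positivity
  obtain ⟨hsw, hwm⟩ := (windowProfile_ne_zero_iff s m hc w).1 h0
  obtain ⟨v, hv⟩ : ∃ v, w = v + 1 := ⟨w - 1, by omega⟩
  have hs' : (s : ℝ) + 1 ≤ w := by exact_mod_cast hsw
  have hm' : (w : ℝ) + 1 ≤ s + m := by exact_mod_cast hwm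
  have hm2 : (2 : ℝ) ≤ m := by exact_mod_cast hm
  -- with `j = w - s`, the polynomial `j (m - j)` is positive at `w` and nonnegative at `w ± 1`
  set j : ℝ := w - s with hj
  have hj1 : 1 ≤ j := by linarith
  have hjm : j ≤ m - 1 := by linarith
  have e0 : windowProfile s m c w = c ^ w * (j * (m - j)) := by
    rw [windowProfile, max_eq_right]
    · congr 2; ring
    · exact mul_nonneg (by linarith) (by linarith)
  have e1 : windowProfile s m c (w - 1) = c ^ w * ((j - 1) * (m - j + 1)) / c := by
    have hc1 : ((w - 1 : ℕ) : ℝ) = w - 1 := by rw [hv]; simp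
    rw [windowProfile, hc1, max_eq_right]
    · rw [show c ^ w = c ^ (w - 1) * c by rw [hv]; simp [pow_succ]]
      field_simp
      ring
    · exact mul_nonneg (by linarith) (by linarith)
  have e2 : windowProfile s m c (w + 1) = c ^ w * ((j + 1) * (m - j - 1)) * c := by
    rw [windowProfile, max_eq_right]
    · rw [pow_succ]; push_cast; ring
    · push_cast
      exact mul_nonneg (by linarith) (by linarith)
  have hcw : 0 < c ^ w := pow_pos hc w
  have hP1 : 0 ≤ (j - 1) * (m - j + 1) := mul_nonneg (by linarith) (by linarith)
  have hP2 : 0 ≤ (j + 1) * (m - j - 1) := mul_nonneg (by linarith) (by linarith)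
  have k1 : K ≤ w / c := h1.trans (by gcongr)
  have k2 : K ≤ (n - w) * (q - 1) * c := h2.trans <|
    mul_le_mul_of_nonneg_right (mul_le_mul_of_nonneg_right (by linarith) (by linarith)) hc.le
  have hP0 : (m : ℝ) - 1 ≤ j * (m - j) := by nlinarith
  have hpar : (2 - 2 / ((m : ℝ) - 1)) * (j * (m - j)) ≤
      (j - 1) * (m - j + 1) + (j + 1) * (m - j - 1) := by
    have h3 : 2 ≤ 2 / ((m : ℝ) - 1) * (j * (m - j)) := by
      rw [div_mul_eq_mul_div, le_div_iff₀ (by linarith)]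
      linarith
    linarith
  rw [e0, e1, e2]
  have m1 := mul_le_mul_of_nonneg_right k1 hP1
  have m2 := mul_le_mul_of_nonneg_right k2 hP2
  have m3 := mul_le_mul_of_nonneg_left hpar hK
  have m4 : (q - 2) * s * (j * (m - j)) ≤ (q - 2) * w * (j * (m - j)) := by
    gcongr
    linarith
  calc (n + (q - 2) * s + (2 - 2 / ((m : ℝ) - 1)) * K) * (c ^ w * (j * (m - j)))
      = c ^ w * (n * (j * (m - j)) + (q - 2) * s * (j * (m - j))
          + K * ((2 - 2 / ((m : ℝ) - 1)) * (j * (m - j)))) := by ring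
    _ ≤ c ^ w * (n * (j * (m - j)) + (q - 2) * w * (j * (m - j))
          + (w / c * ((j - 1) * (m - j + 1)) +
            (n - w) * (q - 1) * c * ((j + 1) * (m - j - 1)))) := by
        gcongr; linarith
    _ = _ := by field_simp; ring

/-- The coordinate subspace of the words supported on `S`, as a finite set. -/
def subcube (F : Type*) [Field F] [Fintype F] [DecidableEq F] (S : Finset ι) : Finset (ι → F) :=
  Fintype.piFinset fun i => if i ∈ S then univ else {0}

theorem mem_subcube {S : Finset ι} {e : ι → F} : e ∈ subcube F S ↔ ∀ i ∉ S, e i = 0 := by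
  rw [subcube, Fintype.mem_piFinset]
  refine forall_congr' fun i => ?_
  by_cases h : i ∈ S <;> simp [h]

theorem card_subcube (S : Finset ι) : #(subcube F S) = Fintype.card F ^ #S := by
  rw [subcube, Fintype.card_piFinset]
  simp_rw [apply_ite card, card_singleton, card_univ]
  rw [prod_ite]
  simp

/-- The indicator function of the coordinate subspace on `S` is a super-eigenfunction: a line in
a direction of `S` stays in the subspace, any other line meets it in one point. -/
theorem le_lineSum_indicator_subcube (S : Finset ι) (e : ι → F) :
    ((Fintype.card F - 1) * (#S : ℝ) + Fintype.card ι) * (if e ∈ subcube F S then 1 else 0) ≤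
      lineSum (fun e : ι → F => if e ∈ subcube F S then (1 : ℝ) else 0) e := by
  split_ifs with h
  · have h1 : ∀ i, (if i ∈ S then (Fintype.card F : ℝ) else 1) ≤
        ∑ a : F, if Function.update e i a ∈ subcube F S then (1 : ℝ) else 0 := by
      intro i
      split_ifs with hi
      · rw [sum_congr rfl (g := fun _ => (1 : ℝ))]
        · simp
        · intro a _
          rw [if_pos]
          rw [mem_subcube] at h ⊢
          intro k hk
          rw [Function.update_of_ne (by rintro rfl; exact hk hi)]
          exact h k hk
      · refine le_trans ?_ (single_le_sum (f := fun a : F =>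
          if Function.update e i a ∈ subcube F S then (1 : ℝ) else 0)
          (fun a _ => by positivity) (mem_univ (e i)))
        simp only [Function.update_eq_self]
        rw [if_pos h]
    refine le_trans (le_of_eq ?_) (sum_le_sum fun i _ => h1 i)
    rw [sum_ite, sum_const, sum_const, filter_mem_eq_inter, univ_inter, nsmul_eq_mul, nsmul_eq_mul,
      filter_not, filter_mem_eq_inter, univ_inter, ← compl_eq_univ_sdiff, card_compl,
      Nat.cast_sub (card_le_univ S)]
    ring
  · rw [mul_zero]
    exact sum_nonneg fun i _ => sum_nonneg fun a _ => by positivity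

/-- The entropy bound for the size of a Hamming ball. -/
theorem card_hammingBall_le {x : ℝ} (hx0 : 0 < x)
    (hx1 : x < 1 - 1 / (Fintype.card F : ℝ)) :
    (#{e : ι → F | (hammingNorm e : ℝ) ≤ x * Fintype.card ι} : ℝ) ≤
      Real.exp (Fintype.card ι * Real.qaryEntropy (Fintype.card F) x) := by
  have hq : (2 : ℝ) ≤ Fintype.card F := by exact_mod_cast Fintype.one_lt_card (α := F)
  set q : ℝ := (Fintype.card F : ℝ) with hqdef
  set n : ℝ := (Fintype.card ι : ℝ)
  have hxq : x * q < q - 1 := by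
    have : x * q < (1 - 1 / q) * q := by gcongr
    rwa [sub_mul, one_mul, one_div, inv_mul_cancel₀ (by positivity)] at this
  have hx1' : 0 < 1 - x := by nlinarith
  have hxq' : 0 < x / (q - 1) := div_pos hx0 (by linarith)
  -- the product distribution with `P(0) = 1 - x` and the other letters equally likely
  let φ : F → ℝ := fun a => if a = 0 then 1 - x else x / (q - 1)
  have hφ1 : ∑ a, φ a = 1 := by
    rw [← add_sum_erase _ _ (mem_univ (0 : F)), sum_congr rfl (g := fun _ => x / (q - 1))]
    · rw [sum_const, card_erase_of_mem (mem_univ _), card_univ, nsmul_eq_mul,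
        Nat.cast_sub Fintype.card_pos, ← hqdef]
      have : q - 1 ≠ 0 := by linarith
      simp [φ]
      field_simp
      ring
    · intro a ha
      simp [φ, ne_of_mem_erase ha]
  have hφ0 : ∀ a, 0 < φ a := fun a => by
    by_cases h : a = 0 <;> simp [φ, h, hx1', hxq']
  have hprod : ∑ e : ι → F, ∏ i, φ (e i) = 1 := by
    have := prod_univ_sum (fun _ : ι => (univ : Finset F)) (fun _ => φ)
    simpa [hφ1, Fintype.piFinset_univ] using this.symm
  have hlog : ∀ e : ι → F, Real.log (∏ i, φ (e i)) =
      n * Real.log (1 - x) + hammingNorm e * (Real.log (x / (q - 1)) - Real.log (1 - x)) := by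
    intro e
    rw [Real.log_prod (fun i _ => (hφ0 _).ne'), hammingNorm, card_filter, Nat.cast_sum, sum_mul]
    have : n * Real.log (1 - x) = ∑ i : ι, Real.log (1 - x) := by simp [n]
    rw [this, ← sum_add_distrib]
    refine sum_congr rfl fun i _ => ?_
    by_cases h : e i = 0 <;> simp [φ, h]
  have hneg : Real.log (x / (q - 1)) - Real.log (1 - x) ≤ 0 := by
    rw [sub_nonpos]
    refine Real.log_le_log hxq' ?_
    rw [div_le_iff₀ (by linarith)]
    linarith
  have hterm : ∀ e ∈ ({e : ι → F | (hammingNorm e : ℝ) ≤ x * n} : Finset (ι → F)),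
      Real.exp (-(n * Real.qaryEntropy (Fintype.card F) x)) ≤ ∏ i, φ (e i) := by
    intro e he
    have he' : (hammingNorm e : ℝ) ≤ x * n := (mem_filter.1 he).2
    rw [← Real.le_log_iff_exp_le (prod_pos fun i _ => hφ0 _), hlog]
    refine le_trans (le_of_eq ?_)
      (add_le_add_right (mul_le_mul_of_nonpos_right he' hneg) _)
    rw [Real.qaryEntropy, Real.binEntropy, Real.log_inv, Real.log_inv,
      Real.log_div hx0.ne' (by linarith)]
    push_cast
    ring
  have hsum := card_nsmul_le_sum _ _ _ hterm
  have hle : ∑ e ∈ ({e : ι → F | (hammingNorm e : ℝ) ≤ x * n} : Finset (ι → F)),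
      ∏ i, φ (e i) ≤ 1 := by
    rw [← hprod]
    exact sum_le_sum_of_subset_of_nonneg (subset_univ _)
      fun e _ _ => prod_nonneg fun i _ => (hφ0 _).le
  rw [nsmul_eq_mul, Real.exp_neg] at hsum
  have := hsum.trans hle
  rwa [← div_eq_mul_inv, div_le_one (Real.exp_pos _)] at this

end Windows

/-! ### Intersecting codes and disjoint zero-sum subsequences -/

section Intersecting

open Finset Module

/-- A linear code is intersecting if any two of its nonzero words are simultaneously nonzero at
some coordinate. -/
def Submodule.IsIntersecting {F ι : Type*} [Field F] (C : Submodule F (ι → F)) : Prop :=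
  ∀ c ∈ C, ∀ c' ∈ C, c ≠ 0 → c' ≠ 0 → ∃ i, c i ≠ 0 ∧ c' i ≠ 0

theorem Submodule.IsIntersecting.finrank_le_hammingNorm {F ι : Type*} [Field F] [Fintype ι]
    [DecidableEq F] {C : Submodule F (ι → F)} (hC : C.IsIntersecting) {c : ι → F} (hc : c ∈ C)
    (hc0 : c ≠ 0) : finrank F C ≤ hammingNorm c := by
  -- restriction to the support of `c` is injective on `C`
  let π : C →ₗ[F] ({i // c i ≠ 0} → F) := (LinearMap.funLeft F F Subtype.val).comp C.subtype
  have hπ : Function.Injective π := by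
    rw [← LinearMap.ker_eq_bot, LinearMap.ker_eq_bot']
    intro c' h
    by_contra h0
    obtain ⟨i, hi, hi'⟩ := hC c hc c' c'.2 hc0 (by simpa using h0)
    exact hi' (congrFun h ⟨i, hi⟩)
  have := LinearMap.finrank_le_finrank_of_injective hπ
  rwa [finrank_fintype_fun_eq_card, Fintype.card_subtype] at this

/-- The linear relations between the terms of a sequence without two disjoint weighted zero-sum
subsequences form an intersecting code. -/
theorem exists_isIntersecting_of_not_hasDisjointZeroSums {p h r n : ℕ} {F : Type*} [Field F]
    (φ : ElemAbelian p (h * r) ≃+ (Fin r → F)) (a : Fin n → ElemAbelian p (h * r))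
    (ha : ¬ HasDisjointZeroSums (scalarWeights F φ) 2 a) :
    ∃ C : Submodule F (Fin n → F), C.IsIntersecting ∧ n ≤ finrank F C + r := by
  classical
  let T : (Fin n → F) →ₗ[F] (Fin r → F) := Fintype.linearCombination F fun i => φ (a i)
  refine ⟨LinearMap.ker T, fun c hc c' hc' hc0 hc0' => ?_, ?_⟩
  · have key : ∀ b : Fin n → F, b ∈ LinearMap.ker T → b ≠ 0 →
        IsWeightedZeroSum (scalarWeights F φ) a {i | b i ≠ 0} := by
      intro b hb hb0
      refine ⟨?_, fun i => scalarWeight φ (b i), ?_, ?_⟩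
      · obtain ⟨i, hi⟩ := Function.ne_iff.1 hb0
        exact ⟨i, by simpa using hi⟩
      · intro i hi
        exact ⟨b i, (mem_filter.1 hi).2, rfl⟩
      · apply φ.injective
        rw [LinearMap.mem_ker, Fintype.linearCombination_apply] at hb
        rw [map_sum, map_zero, ← hb, sum_filter]
        refine sum_congr rfl fun i _ => ?_
        by_cases hi : b i = 0 <;> simp [hi, scalarWeight_apply]
    by_contra! hdis
    have hd : Disjoint ({i | c i ≠ 0} : Finset (Fin n)) ({i | c' i ≠ 0} : Finset (Fin n)) := by
      rw [disjoint_left]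
      intro i hi hi'
      exact (mem_filter.1 hi').2 (hdis i (mem_filter.1 hi).2)
    refine ha ⟨![({i | c i ≠ 0} : Finset (Fin n)), ({i | c' i ≠ 0} : Finset (Fin n))], ?_, ?_⟩
    · intro s
      fin_cases s
      · exact key c hc hc0
      · exact key c' hc' hc0'
    · intro s t hst
      fin_cases s <;> fin_cases t
      · exact absurd rfl hst
      · exact hd
      · exact hd.symm
      · exact absurd rfl hst
  · have h1 := T.finrank_range_add_finrank_ker
    have h2 := (LinearMap.range T).finrank_le
    simp only [finrank_fintype_fun_eq_card, Fintype.card_fin] at h1 h2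
    omega

/-- A bound `k ≤ θ n` on the dimensions of long intersecting codes bounds the Davenport constant,
by applying it to a sequence of length one less than the constant. -/
theorem scalarDavenport_le {p h r : ℕ} {F : Type*} [Field F]
    (φ : ElemAbelian p (h * r) ≃+ (Fin r → F)) {θ : ℝ} (hθ : θ < 1) {N : ℕ}
    (hN : ∀ n ≥ N, ∀ C : Submodule F (Fin n → F), C.IsIntersecting → (finrank F C : ℝ) ≤ θ * n) :
    (scalarDavenport φ 2 : ℝ) ≤ 1 / (1 - θ) * r + (N + 1) := by
  have hθ' : 0 < 1 - θ := by linarith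
  rcases Nat.eq_zero_or_pos (scalarDavenport φ 2) with h0 | h0
  · rw [h0, Nat.cast_zero]; positivity
  obtain ⟨l, hl⟩ : ∃ l, scalarDavenport φ 2 = l + 1 := ⟨_, (Nat.sub_add_cancel h0).symm⟩
  have hlt : ¬ ∀ a : Fin l → ElemAbelian p (h * r),
      HasDisjointZeroSums (scalarWeights F φ) 2 a := by
    intro hall
    have := (scalarDavenport_isLeast φ 2).2 hall
    omega
  push Not at hlt
  obtain ⟨a, ha⟩ := hlt
  obtain ⟨C, hC, hCr⟩ := exists_isIntersecting_of_not_hasDisjointZeroSums φ a ha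
  have hr : (0 : ℝ) ≤ 1 / (1 - θ) * r := by positivity
  rw [hl]
  push_cast
  rcases lt_or_ge l N with hlN | hlN
  · have : (l : ℝ) ≤ N := by exact_mod_cast hlN.le
    linarith
  · have h1 := hN l hlN C hC
    have h2 : (l : ℝ) ≤ finrank F C + r := by exact_mod_cast hCr
    have h3 : (l : ℝ) ≤ 1 / (1 - θ) * r := by
      rw [one_div_mul_eq_div, le_div_iff₀ hθ']
      linarith
    have : (0 : ℝ) ≤ N := Nat.cast_nonneg N
    linarith

theorem limsup_scalarDavenport_le {p h : ℕ} {F : Type*} [Field F]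
    (φ : ∀ r : ℕ, ElemAbelian p (h * r) ≃+ (Fin r → F)) {θ : ℝ} (hθ : θ < 1)
    (hN : ∀ᶠ n : ℕ in atTop, ∀ C : Submodule F (Fin n → F), C.IsIntersecting →
      (finrank F C : ℝ) ≤ θ * n) :
    limsup (fun r : ℕ => (((scalarDavenport (φ r) 2 : ℝ) / (r : ℝ) : ℝ) : EReal)) atTop
      ≤ ((1 / (1 - θ) : ℝ) : EReal) := by
  obtain ⟨N, hN⟩ := eventually_atTop.1 hN
  have hlim : Tendsto (fun r : ℕ => (((1 / (1 - θ) + (N + 1) / r : ℝ)) : EReal)) atTop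
      (nhds ((1 / (1 - θ) : ℝ) : EReal)) := by
    refine (continuous_coe_real_ereal.tendsto _).comp ?_
    simpa using (tendsto_const_nhds (x := 1 / (1 - θ))).add
      (tendsto_const_div_atTop_nhds_zero_nat ((N : ℝ) + 1))
  refine le_trans (limsup_le_limsup ?_) hlim.limsup_eq.le
  filter_upwards [eventually_gt_atTop 0] with r hr
  have hr' : (0 : ℝ) < r := by exact_mod_cast hr
  refine EReal.coe_le_coe_iff.2 ?_
  rw [div_le_iff₀ hr', add_mul, div_mul_cancel₀ _ hr'.ne']
  exact scalarDavenport_le (φ r) hθ hN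

/-- If there are test functions for the minimum distance `θ n` with at most `exp (σ n + b)` points
in their supports, where `σ < θ log q`, then long intersecting codes have rate at most `θ`: a code
of larger dimension would also have minimum distance at least `θ n`, and would be too large. -/
theorem eventually_finrank_le_of_testFunctions {F : Type*} [Field F] [Fintype F] [DecidableEq F]
    {θ σ b : ℝ} (hσ : σ < θ * Real.log (Fintype.card F))
    (hf : ∀ᶠ n : ℕ in atTop, ∃ (f : (Fin n → F) → ℝ) (l : ℝ) (S : Finset (Fin n → F)),
      (∀ e, 0 ≤ f e) ∧ (∃ e, f e ≠ 0) ∧ (∀ e, f e ≠ 0 → e ∈ S) ∧ (∀ e, l * f e ≤ lineSum f e) ∧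
      Fintype.card F * ((n : ℝ) - θ * n) + 1 ≤ l ∧ (#S : ℝ) ≤ Real.exp (σ * n + b)) :
    ∀ᶠ n : ℕ in atTop, ∀ C : Submodule F (Fin n → F), C.IsIntersecting →
      (finrank F C : ℝ) ≤ θ * n := by
  set q : ℝ := (Fintype.card F : ℝ) with hq
  have hq2 : (2 : ℝ) ≤ q := by rw [hq]; exact_mod_cast Fintype.one_lt_card (α := F)
  set δ := θ * Real.log q - σ with hδ
  have hδ0 : 0 < δ := by linarith
  have hlogn : ∀ᶠ n : ℕ in atTop, Real.log n ≤ δ / 2 * n := by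
    have := (Real.isLittleO_log_id_atTop.comp_tendsto tendsto_natCast_atTop_atTop).bound
      (half_pos hδ0)
    filter_upwards [this] with n hn
    refine (le_abs_self _).trans (hn.trans_eq ?_)
    simp
  have hbig : ∀ᶠ n : ℕ in atTop, Real.log q + b < δ / 2 * n :=
    (tendsto_natCast_atTop_atTop.const_mul_atTop (half_pos hδ0)).eventually_gt_atTop _
  filter_upwards [hf, hlogn, hbig, eventually_gt_atTop 0] with n hfn hln hbn hn C hC
  obtain ⟨f, l, S, hf0, hne, hS, hfl, hl, hcard⟩ := hfn
  by_contra! hk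
  have hn' : (0 : ℝ) < n := by exact_mod_cast hn
  let _ : Fintype C := Fintype.ofFinite C
  have h1 := card_le_of_le_lineSum (M := C) (fun i => (LinearMap.proj i).comp C.subtype)
    (finrank F C) (fun c hc => hC.finrank_le_hammingNorm c.2 (by simpa using hc)) f hf0 hne l
    (by
      refine le_trans ?_ hl
      rw [Fintype.card_fin]
      gcongr) hfl S hS
  have hkn : (finrank F C : ℝ) ≤ n := by
    have := C.finrank_le
    rw [finrank_fintype_fun_eq_card, Fintype.card_fin] at this
    exact_mod_cast this
  have h2 : (Fintype.card C : ℝ) = Real.exp (finrank F C * Real.log q) := by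
    rw [Module.card_eq_pow_finrank (K := F), Nat.cast_pow, ← hq, Real.exp_nat_mul,
      Real.exp_log (by linarith)]
  have h3 : Real.exp (finrank F C * Real.log q) ≤
      Real.exp (Real.log q + Real.log n + (σ * n + b)) := by
    rw [← h2, Real.exp_add, Real.exp_add, Real.exp_log (by linarith), Real.exp_log hn']
    refine h1.trans ?_
    gcongr
  have h4 := Real.exp_le_exp.1 h3
  have h5 : θ * n * Real.log q ≤ finrank F C * Real.log q := by
    have : 0 ≤ Real.log q := Real.log_nonneg (by linarith)
    gcongr
  have : δ * n = θ * n * Real.log q - σ * n := by rw [hδ]; ring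
  linarith

end Intersecting

/-! ### The Plotkin bound and the first linear programming bound for intersecting codes -/

section Asymptotic

open Finset Module

theorem exists_hammingNorm_eq {F ι : Type*} [Field F] [DecidableEq F] [Fintype ι] {w : ℕ}
    (hw : w ≤ Fintype.card ι) : ∃ e : ι → F, hammingNorm e = w := by
  classical
  obtain ⟨T, -, hT⟩ := exists_subset_card_eq (s := (univ : Finset ι)) hw
  refine ⟨fun i => if i ∈ T then 1 else 0, ?_⟩
  rw [hammingNorm, ← hT]
  congr 1
  ext i
  by_cases h : i ∈ T <;> simp [h]

theorem eventually_finrank_le_plotkin {F : Type*} [Field F] [Fintype F] {θ : ℝ}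
    (h1 : ((Fintype.card F : ℝ) - 1) / (2 * Fintype.card F - 1) < θ)
    (h2 : θ < 1 - 1 / (Fintype.card F : ℝ)) :
    ∀ᶠ n : ℕ in atTop, ∀ C : Submodule F (Fin n → F), C.IsIntersecting →
      (finrank F C : ℝ) ≤ θ * n := by
  classical
  have hq2 : (2 : ℝ) ≤ Fintype.card F := by exact_mod_cast Fintype.one_lt_card (α := F)
  set q : ℝ := (Fintype.card F : ℝ) with hq
  have hlog : 0 < Real.log q := Real.log_pos (by linarith)
  have hq1 : 0 < q - 1 := by linarith
  rw [div_lt_iff₀ (by linarith)] at h1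
  have h2' : θ * q < q - 1 := by
    have : θ * q < (1 - 1 / q) * q := by gcongr
    rwa [sub_mul, one_mul, one_div, inv_mul_cancel₀ (by positivity)] at this
  -- the proportion of free coordinates that the eigenvalue condition requires
  set κ := 1 - q * θ / (q - 1) with hκ
  have hκ' : κ * (q - 1) = q - 1 - q * θ := by rw [hκ]; field_simp
  have hκ0 : 0 < κ := by
    by_contra! h
    nlinarith
  have hκθ : κ < θ := by
    refine lt_of_mul_lt_mul_right (a := q - 1) ?_ hq1.le
    linarith
  have hθ1 : θ < 1 := h2.trans (sub_lt_self _ (by positivity))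
  refine eventually_finrank_le_of_testFunctions (σ := κ * Real.log q) (b := 2 * Real.log q)
    (mul_lt_mul_of_pos_right hκθ hlog) ?_
  have hbig : ∀ᶠ n : ℕ in atTop, 2 < (1 - κ) * (n : ℝ) :=
    (tendsto_natCast_atTop_atTop.const_mul_atTop (by linarith)).eventually_gt_atTop _
  filter_upwards [hbig] with n hn
  have hceil := Nat.ceil_lt_add_one (show 0 ≤ κ * n by positivity)
  have hceil' := Nat.le_ceil (κ * n)
  have hj : ⌈κ * n⌉₊ + 1 ≤ Fintype.card (Fin n) := by
    rw [Fintype.card_fin]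
    have : ((⌈κ * n⌉₊ + 1 : ℕ) : ℝ) ≤ n := by push_cast; linarith
    exact_mod_cast this
  obtain ⟨T, -, hT⟩ := exists_subset_card_eq (s := (univ : Finset (Fin n))) hj
  refine ⟨fun e => if e ∈ subcube F T then 1 else 0, _, subcube F T, fun e => by positivity,
    ⟨0, by simp [mem_subcube]⟩, fun e he => ?_, le_lineSum_indicator_subcube T, ?_, ?_⟩
  · by_contra h
    exact he (if_neg h)
  · rw [hT, Fintype.card_fin, ← hq]
    push_cast
    have := mul_le_mul_of_nonneg_left hceil' hq1.le
    nlinarith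
  · rw [card_subcube, hT, Nat.cast_pow, ← hq, ← Real.exp_log (show 0 < q by linarith),
      ← Real.exp_nat_mul, Real.log_exp]
    refine Real.exp_le_exp.2 ?_
    push_cast
    nlinarith

theorem eventually_finrank_le_mrrw {F : Type*} [Field F] [Fintype F] {θ x : ℝ}
    (hx0 : 0 < x) (hx1 : x < 1 - 1 / (Fintype.card F : ℝ))
    (hH : Real.qaryEntropy (Fintype.card F) x < θ * Real.log (Fintype.card F))
    (hgap : (Fintype.card F : ℝ) - 1 - Fintype.card F * θ <
      (Fintype.card F - 2) * x + 2 * √((Fintype.card F - 1) * x * (1 - x))) :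
    ∀ᶠ n : ℕ in atTop, ∀ C : Submodule F (Fin n → F), C.IsIntersecting →
      (finrank F C : ℝ) ≤ θ * n := by
  classical
  have hq2 : (2 : ℝ) ≤ Fintype.card F := by exact_mod_cast Fintype.one_lt_card (α := F)
  set q : ℝ := (Fintype.card F : ℝ) with hq
  have hq1 : 0 < q - 1 := by linarith
  have hx1' : 0 < 1 - x := by
    have : 0 < 1 / q := by positivity
    linarith
  set κ := √((q - 1) * x * (1 - x)) with hκ
  have hκ0 : 0 < κ := Real.sqrt_pos.2 (by positivity)
  have hκ2 : κ ^ 2 = (q - 1) * x * (1 - x) := Real.sq_sqrt (by positivity)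
  -- the ratio of consecutive values of the window profile balances the two off-diagonal terms
  set c := x / κ with hc
  have hc0 : 0 < c := by positivity
  have hxc : x / c = κ := by rw [hc]; field_simp
  have hxc' : (1 - x) * (q - 1) * c = κ := by
    rw [hc]; field_simp; linarith
  set g := (q - 2) * x + 2 * κ - (q - 1 - q * θ) with hg
  have hg0 : 0 < g := by linarith
  -- a window so long that the loss factor of the parabola uses up less than half of the gap `g`
  obtain ⟨k, hk⟩ := exists_nat_gt (4 * κ / g)
  have hk0 : (0 : ℝ) < k := lt_trans (by positivity) hk
  have hη : 2 / (((k + 1 : ℕ) : ℝ) - 1) * κ < g / 2 := by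
    push_cast
    rw [add_sub_cancel_right, div_mul_eq_mul_div, div_lt_iff₀ hk0]
    rw [div_lt_iff₀ hg0] at hk
    linarith
  have hk1 : 1 ≤ k := by exact_mod_cast Nat.one_le_iff_ne_zero.2 (by rintro rfl; simp at hk0)
  set m := k + 1 with hm
  set η := 2 / ((m : ℝ) - 1) with hηdef
  have hη0 : 0 ≤ η := by rw [hηdef, hm]; push_cast; rw [add_sub_cancel_right]; positivity
  have hη2 : η ≤ 2 := by
    rw [hηdef, hm]; push_cast
    rw [add_sub_cancel_right, div_le_iff₀ hk0]
    have : (1 : ℝ) ≤ k := by exact_mod_cast hk1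
    linarith
  refine eventually_finrank_le_of_testFunctions (b := 0) hH ?_
  have hb1 : ∀ᶠ n : ℕ in atTop, ((m : ℝ) + 1) < x * (n : ℝ) :=
    (tendsto_natCast_atTop_atTop.const_mul_atTop hx0).eventually_gt_atTop _
  have hb2 : ∀ᶠ n : ℕ in atTop, ((m : ℝ) + 1) / c < κ * (n : ℝ) :=
    (tendsto_natCast_atTop_atTop.const_mul_atTop hκ0).eventually_gt_atTop _
  have hb3 : ∀ᶠ n : ℕ in atTop,
      (q - 2) * (m + 1) + (2 - η) * (((m : ℝ) + 1) / c) + 1 < g / 2 * (n : ℝ) :=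
    (tendsto_natCast_atTop_atTop.const_mul_atTop (half_pos hg0)).eventually_gt_atTop _
  filter_upwards [hb1, hb2, hb3] with n h1 h2 h3
  have hxn : 0 ≤ x * n := by positivity
  have hfl := Nat.floor_le hxn
  have hfl' := Nat.lt_floor_add_one (x * n)
  obtain ⟨s, hs⟩ : ∃ s, ⌊x * n⌋₊ = s + m := by
    refine ⟨⌊x * n⌋₊ - m, (Nat.sub_add_cancel ?_).symm⟩
    exact Nat.le_floor (by linarith)
  rw [hs] at hfl hfl'
  push_cast at hfl hfl'
  have hsn : s + m ≤ n := by
    have : ((s + m : ℕ) : ℝ) ≤ n := by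
      push_cast
      have : x * n ≤ 1 * n := by gcongr; linarith
      linarith
    exact_mod_cast this
  -- a lower bound for both balanced off-diagonal terms, from `s ≥ x n - (m + 1)`
  set K := κ * n - (m + 1) / c with hK
  have hK0 : 0 ≤ K := by linarith
  refine ⟨fun e => windowProfile s m c (hammingNorm e), _,
    ({e | (hammingNorm e : ℝ) ≤ x * Fintype.card (Fin n)} : Finset (Fin n → F)),
    fun e => windowProfile_nonneg s m hc0 _, ?_, fun e he => ?_,
    le_lineSum_windowProfile s m (by omega) hc0 hK0 ?_ ?_, ?_, ?_⟩
  · obtain ⟨e, he⟩ := exists_hammingNorm_eq (F := F) (ι := Fin n) (w := s + 1)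
      (by rw [Fintype.card_fin]; omega)
    refine ⟨e, ?_⟩
    beta_reduce
    rw [he, windowProfile_ne_zero_iff s m hc0]
    omega
  · rw [mem_filter, Fintype.card_fin]
    refine ⟨mem_univ _, le_trans ?_ hfl⟩
    exact_mod_cast ((windowProfile_ne_zero_iff s m hc0 _).1 he).2.le
  · rw [hK, ← hxc, div_mul_eq_mul_div, ← sub_div]
    gcongr
    linarith
  · rw [Fintype.card_fin, hK, ← hq]
    have h4 : 0 ≤ ((m : ℝ) + 1) / c := by positivity
    have h5 : (1 - x) * n * (q - 1) * c ≤ (n - s - m) * (q - 1) * c := by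
      gcongr
      linarith
    have h6 : κ * n = (1 - x) * n * (q - 1) * c := by rw [← hxc']; ring
    linarith
  · rw [Fintype.card_fin, ← hq, ← hηdef]
    have h4 : (q - 2) * (x * n - (m + 1)) ≤ (q - 2) * s := by
      gcongr
      linarith
    have h5 : η * κ * n ≤ g / 2 * n := by gcongr
    have h6 : g * n = (q - 2) * x * n + 2 * κ * n - (q - 1 - q * θ) * n := by rw [hg]; ring
    have h7 : (2 - η) * K = 2 * κ * n - η * κ * n - (2 - η) * ((m + 1) / c) := by
      rw [hK]; ring
    rw [h7]
    linarith
  · have := card_hammingBall_le (F := F) (ι := Fin n) hx0 hx1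
    rw [add_zero, mul_comm (Real.qaryEntropy _ _)]
    simpa only [Fintype.card_fin] using this

end Asymptotic

/-! ### The function `mrrw` and its fixed point -/

section FirstLinearProgrammingBound

open Set

/-- The argument of the entropy in the definition of `mrrw`. -/
noncomputable def mrrwArg (q : ℕ) (x : ℝ) : ℝ :=
  ((q : ℝ) - 1 - ((q : ℝ) - 2) * x - 2 * √(((q : ℝ) - 1) * x * (1 - x))) / q

theorem mrrw_eq (q : ℕ) (x : ℝ) :
    mrrw q x = Real.qaryEntropy q (mrrwArg q x) / Real.log q := rfl

theorem continuous_mrrwArg (q : ℕ) : Continuous (mrrwArg q) := by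
  unfold mrrwArg
  fun_prop

variable {q : ℕ}

theorem one_sub_inv_mem (hq : 2 ≤ q) : 0 < 1 - 1 / (q : ℝ) ∧ 1 - 1 / (q : ℝ) < 1 := by
  have hq' : (2 : ℝ) ≤ q := by exact_mod_cast hq
  have h1 : 0 < 1 / (q : ℝ) := by positivity
  have h2 : 1 / (q : ℝ) ≤ 1 / 2 := by gcongr
  constructor <;> linarith

/-- In terms of the angle `β` with `√x = sin β` and the angle `α` with `√(1 - 1 / q) = sin α`,
these are the subtraction formulas for `sin (α - β)` and `cos (α - β)`. -/
theorem sqrt_mrrwArg (hq : 2 ≤ q) {x : ℝ} (hx : x ∈ Icc 0 (1 - 1 / (q : ℝ))) :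
    √(mrrwArg q x) = (√(q - 1) * √(1 - x) - √x) / √q ∧
      √(1 - mrrwArg q x) = (√(1 - x) + √(q - 1) * √x) / √q := by
  have hq' : (2 : ℝ) ≤ q := by exact_mod_cast hq
  have hq1 : (0 : ℝ) ≤ q - 1 := by linarith
  have hq0 : (0 : ℝ) < q := by linarith
  have hx1 : 0 ≤ 1 - x := by linarith [hx.2, (one_sub_inv_mem hq).2]
  have hxq : x * q ≤ q - 1 := by
    have : x * q ≤ (1 - 1 / q) * q := by gcongr; exact hx.2
    rwa [sub_mul, one_mul, one_div, inv_mul_cancel₀ (by positivity)] at this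
  have hle : √x ≤ √(q - 1) * √(1 - x) := by
    rw [← Real.sqrt_mul hq1]
    exact Real.sqrt_le_sqrt (by linarith)
  have hs : √(((q : ℝ) - 1) * x * (1 - x)) = √(q - 1) * √x * √(1 - x) := by
    rw [Real.sqrt_mul (mul_nonneg hq1 hx.1), Real.sqrt_mul hq1]
  have s1 := Real.sq_sqrt hq1
  have s2 := Real.sq_sqrt hx.1
  have s3 := Real.sq_sqrt hx1
  have s4 := Real.sq_sqrt hq0.le
  have hs0 : 0 < √(q : ℝ) := Real.sqrt_pos.2 hq0
  have e1 : mrrwArg q x = ((√(q - 1) * √(1 - x) - √x) / √q) ^ 2 := by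
    rw [mrrwArg, hs, div_pow, s4]
    congr 1
    rw [sub_sq, mul_pow, s1, s2, s3]
    ring
  have e2 : 1 - mrrwArg q x = ((√(1 - x) + √(q - 1) * √x) / √q) ^ 2 := by
    rw [mrrwArg, hs, div_pow, s4, eq_div_iff hq0.ne', sub_mul, div_mul_cancel₀ _ hq0.ne',
      add_sq, mul_pow, s1, s2, s3]
    ring
  constructor
  · rw [e1, Real.sqrt_sq (div_nonneg (by linarith) hs0.le)]
  · rw [e2, Real.sqrt_sq (by positivity)]

theorem mrrwArg_zero (hq : 2 ≤ q) : mrrwArg q 0 = 1 - 1 / (q : ℝ) := by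
  have : (q : ℝ) ≠ 0 := by positivity
  simp [mrrwArg]
  field_simp

theorem mrrwArg_strictAntiOn (hq : 2 ≤ q) :
    StrictAntiOn (mrrwArg q) (Icc 0 (1 - 1 / (q : ℝ))) := by
  intro x hx y hy hxy
  have hq' : (2 : ℝ) ≤ q := by exact_mod_cast hq
  refine lt_of_not_ge fun h => ?_
  have h1 := Real.sqrt_le_sqrt h
  rw [(sqrt_mrrwArg hq hx).1, (sqrt_mrrwArg hq hy).1] at h1
  have h2 : √x < √y := Real.sqrt_lt_sqrt hx.1 hxy
  have h3 : √(1 - y) ≤ √(1 - x) := Real.sqrt_le_sqrt (by linarith)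
  have h4 : √((q : ℝ) - 1) * √(1 - y) ≤ √(q - 1) * √(1 - x) := by gcongr
  have h5 := (div_le_div_iff_of_pos_right (Real.sqrt_pos.2 (by linarith : (0 : ℝ) < q))).1 h1
  linarith

theorem mrrwArg_one_sub_inv (hq : 2 ≤ q) : mrrwArg q (1 - 1 / (q : ℝ)) = 0 := by
  have hq' : (2 : ℝ) ≤ q := by exact_mod_cast hq
  have h : ((q : ℝ) - 1) * (1 - 1 / q) * (1 - (1 - 1 / q)) = ((q - 1) / q) ^ 2 := by
    field_simp
    ring
  rw [mrrwArg, h, Real.sqrt_sq (div_nonneg (by linarith) (by linarith))]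
  field_simp
  ring

theorem mrrwArg_mem (hq : 2 ≤ q) {x : ℝ} (hx : x ∈ Icc 0 (1 - 1 / (q : ℝ))) :
    mrrwArg q x ∈ Icc 0 (1 - 1 / (q : ℝ)) := by
  have h0 := (one_sub_inv_mem hq).1.le
  constructor
  · rw [← mrrwArg_one_sub_inv hq]
    exact (mrrwArg_strictAntiOn hq).antitoneOn hx ⟨h0, le_rfl⟩ hx.2
  · rw [← mrrwArg_zero hq]
    exact (mrrwArg_strictAntiOn hq).antitoneOn ⟨le_rfl, h0⟩ hx hx.1

theorem mrrwArg_mrrwArg (hq : 2 ≤ q) {x : ℝ} (hx : x ∈ Icc 0 (1 - 1 / (q : ℝ))) :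
    mrrwArg q (mrrwArg q x) = x := by
  have hq' : (2 : ℝ) ≤ q := by exact_mod_cast hq
  have hm := mrrwArg_mem hq hx
  refine (Real.sqrt_inj (mrrwArg_mem hq hm).1 hx.1).1 ?_
  rw [(sqrt_mrrwArg hq hm).1, (sqrt_mrrwArg hq hx).1, (sqrt_mrrwArg hq hx).2]
  have s1 := Real.mul_self_sqrt (by linarith : (0 : ℝ) ≤ q - 1)
  have s4 := Real.mul_self_sqrt (by linarith : (0 : ℝ) ≤ q)
  have hs0 : 0 < √(q : ℝ) := Real.sqrt_pos.2 (by linarith)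
  rw [← mul_div_assoc, ← sub_div, div_div, s4, div_eq_iff (by linarith)]
  linear_combination √x * s1

theorem mrrw_strictAntiOn (hq : 2 ≤ q) : StrictAntiOn (mrrw q) (Icc 0 (1 - 1 / (q : ℝ))) := by
  intro x hx y hy hxy
  have hlog : 0 < Real.log q := Real.log_pos (by exact_mod_cast hq)
  rw [mrrw_eq, mrrw_eq]
  refine div_lt_div_of_pos_right ?_ hlog
  exact Real.qaryEntropy_strictMonoOn hq (mrrwArg_mem hq hy) (mrrwArg_mem hq hx)
    (mrrwArg_strictAntiOn hq hx hy hxy)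

theorem continuous_mrrw (q : ℕ) : Continuous (mrrw q) :=
  (Real.qaryEntropy_continuous.comp (continuous_mrrwArg q)).div_const _

theorem exists_mrrw_eq_self (hq : 2 ≤ q) :
    ∃ R, 0 < R ∧ R < 1 - 1 / (q : ℝ) ∧ mrrw q R = R := by
  obtain ⟨h0, h1⟩ := one_sub_inv_mem hq
  have hlog : 0 < Real.log q := Real.log_pos (by exact_mod_cast hq)
  have hcont : ContinuousOn (fun x => mrrw q x - x) (Icc 0 (1 - 1 / (q : ℝ))) :=
    ((continuous_mrrw q).sub continuous_id).continuousOn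
  have hpos : 0 < mrrw q 0 := by
    rw [mrrw_eq, mrrwArg_zero hq]
    exact div_pos (Real.qaryEntropy_pos h0 h1) hlog
  have hneg : mrrw q (1 - 1 / (q : ℝ)) = 0 := by
    rw [mrrw_eq, mrrwArg_one_sub_inv hq]
    simp
  obtain ⟨R, hR, hR'⟩ := intermediate_value_Ioo' h0.le hcont
    (show (0 : ℝ) ∈ Ioo _ _ from ⟨by rw [hneg]; linarith, by linarith⟩)
  exact ⟨R, hR.1, hR.2, sub_eq_zero.1 hR'⟩

theorem eq_of_mrrw_eq_self (hq : 2 ≤ q) {x y : ℝ} (hx : x ∈ Icc 0 (1 - 1 / (q : ℝ)))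
    (hy : y ∈ Icc 0 (1 - 1 / (q : ℝ))) (hxm : mrrw q x = x) (hym : mrrw q y = y) : x = y := by
  have := mrrw_strictAntiOn hq
  rcases lt_trichotomy x y with h | h | h
  · have := this hx hy h
    linarith
  · exact h
  · have := this hy hx h
    linarith

section Bracket

variable {R y z : ℝ}

/-- A lower bound for the fixed point `R` of `mrrw` from a point `y` near `mrrwArg q R`: both
`mrrwArg q y` and `H y / log q` are close to `R`, and square roots enter only through the former,
logarithms only through the latter. -/
theorem lt_of_mrrw_eq_self (hq : 2 ≤ q) (hR : R ∈ Icc 0 (1 - 1 / (q : ℝ)))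
    (hRm : mrrw q R = R) (hy : y ∈ Icc 0 (1 - 1 / (q : ℝ))) (hz : z ≤ mrrwArg q y)
    (hzH : z * Real.log q < Real.qaryEntropy q y) : z < R := by
  by_contra! h
  have hlog : 0 < Real.log q := Real.log_pos (by exact_mod_cast hq)
  have h1 := (mrrwArg_strictAntiOn hq).antitoneOn hR (mrrwArg_mem hq hy) (h.trans hz)
  rw [mrrwArg_mrrwArg hq hy] at h1
  have h2 := (Real.qaryEntropy_strictMonoOn hq).monotoneOn hy (mrrwArg_mem hq hR) h1
  rw [mrrw_eq, div_eq_iff hlog.ne'] at hRm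
  have : R * Real.log q ≤ z * Real.log q := by gcongr
  linarith

/-- The upper bound corresponding to `lt_of_mrrw_eq_self`. -/
theorem le_of_mrrw_eq_self (hq : 2 ≤ q) (hR : R ∈ Icc 0 (1 - 1 / (q : ℝ)))
    (hRm : mrrw q R = R) (hy : y ∈ Icc 0 (1 - 1 / (q : ℝ))) (hz : mrrwArg q y ≤ z)
    (hzH : Real.qaryEntropy q y ≤ z * Real.log q) : R ≤ z := by
  by_contra! h
  have hlog : 0 < Real.log q := Real.log_pos (by exact_mod_cast hq)
  have h1 := (mrrwArg_strictAntiOn hq).antitoneOn (mrrwArg_mem hq hy) hR (hz.trans h.le)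
  rw [mrrwArg_mrrwArg hq hy] at h1
  have h2 := (Real.qaryEntropy_strictMonoOn hq).monotoneOn (mrrwArg_mem hq hR) hy h1
  rw [mrrw_eq, div_eq_iff hlog.ne'] at hRm
  have : z * Real.log q < R * Real.log q := by gcongr
  linarith

end Bracket

end FirstLinearProgrammingBound

/-! ### Upper limits of the Davenport constant -/

section Limsup

open Set Topology

variable {p h : ℕ} {F : Type*} [Field F]

theorem limsup_scalarDavenport_le_of_Ioo (φ : ∀ r : ℕ, ElemAbelian p (h * r) ≃+ (Fin r → F))
    {α β : ℝ} (hαβ : α < β) (hβ : β ≤ 1)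
    (hθ : ∀ θ ∈ Ioo α β, ∀ᶠ n : ℕ in atTop, ∀ C : Submodule F (Fin n → F), C.IsIntersecting →
      (Module.finrank F C : ℝ) ≤ θ * n) :
    limsup (fun r : ℕ => (((scalarDavenport (φ r) 2 : ℝ) / (r : ℝ) : ℝ) : EReal)) atTop
      ≤ ((1 / (1 - α) : ℝ) : EReal) := by
  have hlim : Tendsto (fun θ : ℝ => ((1 / (1 - θ) : ℝ) : EReal)) (𝓝[>] α)
      (𝓝 ((1 / (1 - α) : ℝ) : EReal)) := by
    refine (continuous_coe_real_ereal.tendsto _).comp (Tendsto.mono_left ?_ nhdsWithin_le_nhds)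
    exact tendsto_const_nhds.div (tendsto_const_nhds.sub tendsto_id) (by simp; linarith)
  refine ge_of_tendsto hlim ?_
  filter_upwards [Ioo_mem_nhdsGT hαβ] with θ h
  exact limsup_scalarDavenport_le φ (h.2.trans_le hβ) (hθ θ h)

theorem limsup_scalarDavenport_le_plotkin [Fintype F]
    (φ : ∀ r : ℕ, ElemAbelian p (h * r) ≃+ (Fin r → F)) :
    limsup (fun r : ℕ => (((scalarDavenport (φ r) 2 : ℝ) / (r : ℝ) : ℝ) : EReal)) atTop
      ≤ ((2 - 1 / (Fintype.card F : ℝ) : ℝ) : EReal) := by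
  have hq2 : (2 : ℝ) ≤ Fintype.card F := by exact_mod_cast Fintype.one_lt_card (α := F)
  have hq := one_sub_inv_mem (q := Fintype.card F) (Fintype.one_lt_card (α := F))
  set q : ℝ := (Fintype.card F : ℝ)
  have hlt : (q - 1) / (2 * q - 1) < 1 - 1 / q := by
    rw [one_sub_div (by linarith)]
    exact div_lt_div_of_pos_left (by linarith) (by linarith) (by linarith)
  have := limsup_scalarDavenport_le_of_Ioo φ hlt hq.2.le
    fun θ h => eventually_finrank_le_plotkin h.1 h.2
  convert! this using 2
  have : 2 * q - 1 ≠ 0 := by linarith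
  have h1 : 1 - (q - 1) / (2 * q - 1) = q / (2 * q - 1) := by rw [one_sub_div this]; ring
  rw [h1, one_div_div, sub_div, mul_div_assoc, div_self (by linarith), mul_one]

theorem limsup_scalarDavenport_le_mrrw [Fintype F]
    (φ : ∀ r : ℕ, ElemAbelian p (h * r) ≃+ (Fin r → F)) {R : ℝ} (hR0 : 0 < R)
    (hR1 : R < 1 - 1 / (Fintype.card F : ℝ)) (hR : mrrw (Fintype.card F) R = R) :
    limsup (fun r : ℕ => (((scalarDavenport (φ r) 2 : ℝ) / (r : ℝ) : ℝ) : EReal)) atTop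
      ≤ ((1 / (1 - R) : ℝ) : EReal) := by
  have hq : 2 ≤ Fintype.card F := Fintype.one_lt_card (α := F)
  obtain ⟨h0, h1⟩ := one_sub_inv_mem hq
  have hlog : 0 < Real.log (Fintype.card F) := Real.log_pos (by exact_mod_cast hq)
  refine limsup_scalarDavenport_le_of_Ioo φ hR1 h1.le fun θ hθ => ?_
  have hθm : θ ∈ Icc 0 (1 - 1 / (Fintype.card F : ℝ)) := ⟨(hR0.trans hθ.1).le, hθ.2.le⟩
  have hM : mrrw (Fintype.card F) θ < θ :=
    (mrrw_strictAntiOn hq ⟨hR0.le, hR1.le⟩ hθm hθ.1).trans (hR.trans_lt hθ.1)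
  rw [mrrw_eq, div_lt_iff₀ hlog] at hM
  have hμ1 : mrrwArg (Fintype.card F) θ < 1 - 1 / (Fintype.card F : ℝ) := by
    rw [← mrrwArg_zero hq]
    exact mrrwArg_strictAntiOn hq ⟨le_rfl, h0.le⟩ hθm (hR0.trans hθ.1)
  have hev : ∀ᶠ x in 𝓝[>] mrrwArg (Fintype.card F) θ,
      Real.qaryEntropy (Fintype.card F) x < θ * Real.log (Fintype.card F) :=
    nhdsWithin_le_nhds (Real.qaryEntropy_continuous.continuousAt.eventually_lt_const hM)
  obtain ⟨x, hxH, hx⟩ := (hev.and (Ioo_mem_nhdsGT hμ1)).exists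
  have hμm := mrrwArg_mem hq hθm
  have hx0 : 0 < x := hμm.1.trans_lt hx.1
  refine eventually_finrank_le_mrrw hx0 hx.2 hxH ?_
  have h2 := mrrwArg_strictAntiOn hq hμm ⟨hx0.le, hx.2.le⟩ hx.1
  rw [mrrwArg_mrrwArg hq hθm, mrrwArg, div_lt_iff₀ (by positivity)] at h2
  linarith

end Limsup

/-! ### Numerical verification of the table -/

section Numerics

open Set

/-- An approximation of `log z` for `z` near `2 ^ (-k)`: five terms of the series of
`log ((1 + x) / (1 - x))` at the `x` for which this is `log (2 ^ k z)`, minus `k log 2`. -/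
noncomputable def logApprox (k : ℕ) (z : ℝ) : ℝ :=
  2 * ∑ i ∈ Finset.range 5, ((2 ^ k * z - 1) / (2 ^ k * z + 1)) ^ (2 * i + 1) / (2 * i + 1)
    - k * 0.6931471805

theorem abs_log_sub_logApprox_le {k : ℕ} {z : ℝ} (hk : k ≤ 5) (h1 : 2 / 3 ≤ 2 ^ k * z)
    (h2 : 2 ^ k * z ≤ 3 / 2) : |Real.log z - logApprox k z| ≤ 1 / 10 ^ 7 := by
  set u := 2 ^ k * z with hu
  have hz : z ≠ 0 := by
    rintro rfl
    norm_num [hu] at h1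
  set x := (u - 1) / (u + 1) with hx
  have hu1 : 0 < u + 1 := by linarith
  have hxu : (1 + x) / (1 - x) = u := by
    rw [hx]
    field_simp
    ring
  have hx5 : |x| ≤ 1 / 5 := by
    rw [abs_le, hx]
    constructor
    · rw [le_div_iff₀ hu1]; linarith
    · rw [div_le_iff₀ hu1]; linarith
  have hs := Real.sum_range_sub_log_div_le (x := x) (by linarith) 5
  rw [hxu, hu, Real.log_mul (by positivity) hz, Real.log_pow] at hs
  have hx2 : x ^ 2 ≤ 1 / 25 := by
    have := sq_le_sq' (abs_le.1 hx5).1 (abs_le.1 hx5).2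
    linarith
  have herr : |x| ^ (2 * 5 + 1) / (1 - x ^ 2) ≤ (1 / 5) ^ 11 / (24 / 25) := by
    gcongr
    linarith
  have hl1 := Real.log_two_gt_d9
  have hl2 := Real.log_two_lt_d9
  have hk' : (k : ℝ) ≤ 5 := by exact_mod_cast hk
  have hk0 : (0 : ℝ) ≤ k := Nat.cast_nonneg k
  have hkl1 : (k : ℝ) * 0.6931471803 ≤ k * Real.log 2 := by gcongr
  have hkl2 : (k : ℝ) * Real.log 2 ≤ k * 0.6931471808 := by gcongr
  have hs' := abs_le.1 (hs.trans herr)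
  rw [logApprox, abs_le]
  constructor
  · linarith [hs'.1]
  · linarith [hs'.2]

/-- Rational inequalities at a point `y` which place the fixed point of `mrrw` between
`1 - 1 / (B - 10⁻⁴)` and `1 - 1 / B`. The inequalities `ha`, `ha'` and `hb` bound `mrrwArg q y`,
and `hl` and `hu` compare the entropy at `y` with multiples of `log q`, up to the error of
`logApprox`. The exponents `kᵢ` scale the arguments of the logarithms into `[2 / 3, 3 / 2]`. -/
theorem bracket_of_witness {q : ℕ} (hq : 2 ≤ q) {R B y : ℝ} {k₁ k₂ k₃ k₄ : ℕ}
    (hR : R ∈ Icc 0 (1 - 1 / (q : ℝ))) (hRm : mrrw q R = R) (hB : 1 < B - 1 / 10 ^ 4)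
    (hy0 : 0 < y) (hy1 : y ≤ 1 - 1 / (q : ℝ))
    (ha : 0 ≤ q - 1 - (q - 2) * y - q * (1 - 1 / (B - 1 / 10 ^ 4)))
    (ha' : 4 * ((q - 1) * y * (1 - y)) ≤ (q - 1 - (q - 2) * y - q * (1 - 1 / (B - 1 / 10 ^ 4))) ^ 2)
    (hb : (q - 1 - (q - 2) * y - q * (1 - 1 / B)) ^ 2 ≤ 4 * ((q - 1) * y * (1 - y)))
    (hk : k₁ ≤ 5 ∧ k₂ ≤ 5 ∧ k₃ ≤ 5 ∧ k₄ ≤ 5)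
    (h₁ : 2 / 3 ≤ 2 ^ k₁ * (1 / (q : ℝ)) ∧ 2 ^ k₁ * (1 / (q : ℝ)) ≤ 3 / 2)
    (h₂ : 2 / 3 ≤ 2 ^ k₂ * (1 / (q - 1 : ℝ)) ∧ 2 ^ k₂ * (1 / (q - 1 : ℝ)) ≤ 3 / 2)
    (h₃ : 2 / 3 ≤ 2 ^ k₃ * y ∧ 2 ^ k₃ * y ≤ 3 / 2)
    (h₄ : 2 / 3 ≤ 2 ^ k₄ * (1 - y) ∧ 2 ^ k₄ * (1 - y) ≤ 3 / 2)
    (hl : (1 - 1 / (B - 1 / 10 ^ 4)) * (1 / 10 ^ 7 - logApprox k₁ (1 / q)) + 2 / 10 ^ 7 <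
      y * (-logApprox k₂ (1 / (q - 1)) - logApprox k₃ y) - (1 - y) * logApprox k₄ (1 - y))
    (hu : y * (-logApprox k₂ (1 / (q - 1)) - logApprox k₃ y) - (1 - y) * logApprox k₄ (1 - y)
      + 2 / 10 ^ 7 ≤ (1 - 1 / B) * (-1 / 10 ^ 7 - logApprox k₁ (1 / q))) :
    B - 1 / 10 ^ 4 < 1 / (1 - R) ∧ 1 / (1 - R) ≤ B := by
  have hq' : (2 : ℝ) ≤ q := by exact_mod_cast hq
  obtain ⟨-, hq1⟩ := one_sub_inv_mem hq
  have hR1 : 0 < 1 - R := by linarith [hR.2]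
  have hy1' : 0 ≤ 1 - y := by linarith
  have l₁ := abs_le.1 (abs_log_sub_logApprox_le hk.1 h₁.1 h₁.2)
  have l₂ := abs_le.1 (abs_log_sub_logApprox_le hk.2.1 h₂.1 h₂.2)
  have l₃ := abs_le.1 (abs_log_sub_logApprox_le hk.2.2.1 h₃.1 h₃.2)
  have l₄ := abs_le.1 (abs_log_sub_logApprox_le hk.2.2.2 h₄.1 h₄.2)
  have hinv : ∀ t : ℝ, Real.log (1 / t) = -Real.log t := fun t => by rw [one_div, Real.log_inv]
  rw [hinv] at l₁ l₂
  have hent : Real.qaryEntropy q y =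
      y * (Real.log (q - 1) - Real.log y) - (1 - y) * Real.log (1 - y) := by
    rw [Real.qaryEntropy, Real.binEntropy, Real.log_inv, Real.log_inv]
    push_cast
    ring
  have t1 : |y * (Real.log (q - 1) - Real.log y) - (1 - y) * Real.log (1 - y) -
      (y * (-logApprox k₂ (1 / (q - 1)) - logApprox k₃ y) - (1 - y) * logApprox k₄ (1 - y))| ≤
      2 / 10 ^ 7 := by
    have u1 := mul_le_mul_of_nonneg_left l₂.1 hy0.le
    have u2 := mul_le_mul_of_nonneg_left l₂.2 hy0.le
    have u3 := mul_le_mul_of_nonneg_left l₃.1 hy0.le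
    have u4 := mul_le_mul_of_nonneg_left l₃.2 hy0.le
    have u5 := mul_le_mul_of_nonneg_left l₄.1 hy1'
    have u6 := mul_le_mul_of_nonneg_left l₄.2 hy1'
    rw [abs_le]
    constructor <;> linarith
  obtain ⟨t2, t3⟩ := abs_le.1 t1
  have hyI : y ∈ Icc 0 (1 - 1 / (q : ℝ)) := ⟨hy0.le, hy1⟩
  have hs : 2 * √((q - 1) * y * (1 - y)) = √(4 * ((q - 1) * y * (1 - y))) := by
    rw [show (4 : ℝ) = 2 ^ 2 by norm_num, Real.sqrt_mul (by norm_num : (0 : ℝ) ≤ 2 ^ 2),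
      Real.sqrt_sq (by norm_num)]
  constructor
  · have hz : 0 < 1 - 1 / (B - 1 / 10 ^ 4) := by
      rw [sub_pos, div_lt_one (by linarith)]
      exact hB
    have h := lt_of_mrrw_eq_self (z := 1 - 1 / (B - 1 / 10 ^ 4)) hq hR hRm hyI ?_ ?_
    · rw [lt_one_div (by linarith) hR1]
      linarith
    · rw [mrrwArg, le_div_iff₀ (by linarith), hs]
      have := Real.sqrt_le_left ha |>.2 ha'
      linarith
    · rw [hent]
      have : (1 - 1 / (B - 1 / 10 ^ 4)) * Real.log q ≤
          (1 - 1 / (B - 1 / 10 ^ 4)) * (1 / 10 ^ 7 - logApprox k₁ (1 / q)) := by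
        gcongr
        linarith
      linarith
  · have hz : 0 < 1 - 1 / B := by
      rw [sub_pos, div_lt_one (by linarith)]
      linarith
    have h := le_of_mrrw_eq_self (z := 1 - 1 / B) hq hR hRm hyI ?_ ?_
    · rw [one_div_le hR1 (by linarith)]
      linarith
    · rw [mrrwArg, div_le_iff₀ (by linarith), hs]
      have := Real.le_sqrt_of_sq_le hb
      linarith
    · rw [hent]
      have : (1 - 1 / B) * (-1 / 10 ^ 7 - logApprox k₁ (1 / q)) ≤ (1 - 1 / B) * Real.log q := by
        gcongr
        linarith
      linarith

theorem tableBound_bracket {q : ℕ} (hq : IsPrimePow q) (hq17 : q ≤ 17) {R : ℝ}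
    (hR : R ∈ Icc 0 (1 - 1 / (q : ℝ))) (hRm : mrrw q R = R) :
    tableBound q - 1 / 10 ^ 4 < 1 / (1 - R) ∧ 1 / (1 - R) ≤ tableBound q ∧
      tableBound q < 2 - 1 / (q : ℝ) := by
  have hmem : q = 2 ∨ q = 3 ∨ q = 4 ∨ q = 5 ∨ q = 7 ∨ q = 8 ∨ q = 9 ∨ q = 11 ∨ q = 13 ∨ q = 16 ∨
      q = 17 := by
    have h0 := hq.two_le
    interval_cases q <;> first | exact absurd hq (by decide +kernel) | simp
  rw [← and_assoc]
  -- the witnesses `y` approximate `mrrwArg q R`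
  rcases hmem with rfl | rfl | rfl | rfl | rfl | rfl | rfl | rfl | rfl | rfl | rfl <;>
    refine ⟨?_, by norm_num [tableBound]⟩
  · refine bracket_of_witness (y := 0.04932) (k₁ := 1) (k₂ := 0) (k₃ := 4) (k₄ := 0)
      (by norm_num) hR hRm ?_ ?_ ?_ ?_ ?_ ?_ ?_ ?_ ?_ ?_ ?_ ?_ ?_ <;>
      norm_num [tableBound, logApprox, Finset.sum_range_succ]
  · refine bracket_of_witness (y := 0.09799) (k₁ := 2) (k₂ := 1) (k₃ := 3) (k₄ := 0)
      (by norm_num) hR hRm ?_ ?_ ?_ ?_ ?_ ?_ ?_ ?_ ?_ ?_ ?_ ?_ ?_ <;>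
      norm_num [tableBound, logApprox, Finset.sum_range_succ]
  · refine bracket_of_witness (y := 0.13334) (k₁ := 2) (k₂ := 2) (k₃ := 3) (k₄ := 0)
      (by norm_num) hR hRm ?_ ?_ ?_ ?_ ?_ ?_ ?_ ?_ ?_ ?_ ?_ ?_ ?_ <;>
      norm_num [tableBound, logApprox, Finset.sum_range_succ]
  · refine bracket_of_witness (y := 0.159915) (k₁ := 2) (k₂ := 2) (k₃ := 3) (k₄ := 0)
      (by norm_num) hR hRm ?_ ?_ ?_ ?_ ?_ ?_ ?_ ?_ ?_ ?_ ?_ ?_ ?_ <;>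
      norm_num [tableBound, logApprox, Finset.sum_range_succ]
  · refine bracket_of_witness (y := 0.19758) (k₁ := 3) (k₂ := 3) (k₃ := 2) (k₄ := 0)
      (by norm_num) hR hRm ?_ ?_ ?_ ?_ ?_ ?_ ?_ ?_ ?_ ?_ ?_ ?_ ?_ <;>
      norm_num [tableBound, logApprox, Finset.sum_range_succ]
  · refine bracket_of_witness (y := 0.21158) (k₁ := 3) (k₂ := 3) (k₃ := 2) (k₄ := 0)
      (by norm_num) hR hRm ?_ ?_ ?_ ?_ ?_ ?_ ?_ ?_ ?_ ?_ ?_ ?_ ?_ <;>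
      norm_num [tableBound, logApprox, Finset.sum_range_succ]
  · refine bracket_of_witness (y := 0.22346) (k₁ := 3) (k₂ := 3) (k₃ := 2) (k₄ := 0)
      (by norm_num) hR hRm ?_ ?_ ?_ ?_ ?_ ?_ ?_ ?_ ?_ ?_ ?_ ?_ ?_ <;>
      norm_num [tableBound, logApprox, Finset.sum_range_succ]
  · refine bracket_of_witness (y := 0.24264) (k₁ := 3) (k₂ := 3) (k₃ := 2) (k₄ := 0)
      (by norm_num) hR hRm ?_ ?_ ?_ ?_ ?_ ?_ ?_ ?_ ?_ ?_ ?_ ?_ ?_ <;>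
      norm_num [tableBound, logApprox, Finset.sum_range_succ]
  · refine bracket_of_witness (y := 0.25762) (k₁ := 4) (k₂ := 4) (k₃ := 2) (k₄ := 0)
      (by norm_num) hR hRm ?_ ?_ ?_ ?_ ?_ ?_ ?_ ?_ ?_ ?_ ?_ ?_ ?_ <;>
      norm_num [tableBound, logApprox, Finset.sum_range_succ]
  · refine bracket_of_witness (y := 0.27499) (k₁ := 4) (k₂ := 4) (k₃ := 2) (k₄ := 0)
      (by norm_num) hR hRm ?_ ?_ ?_ ?_ ?_ ?_ ?_ ?_ ?_ ?_ ?_ ?_ ?_ <;>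
      norm_num [tableBound, logApprox, Finset.sum_range_succ]
  · refine bracket_of_witness (y := 0.279803) (k₁ := 4) (k₂ := 4) (k₃ := 2) (k₄ := 0)
      (by norm_num) hR hRm ?_ ?_ ?_ ?_ ?_ ?_ ?_ ?_ ?_ ?_ ?_ ?_ ?_ <;>
      norm_num [tableBound, logApprox, Finset.sum_range_succ]

end Numerics

theorem mainTheorem9 (p h : ℕ) (hp : p.Prime) (hh : 1 ≤ h)
    (F : Type*) [Field F] (hF : Nat.card F = p ^ h)
    (φ : ∀ r : ℕ, ElemAbelian p (h * r) ≃+ (Fin r → F)) :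
    limsup (fun r : ℕ => (((scalarDavenport (φ r) 2 : ℝ) / (r : ℝ) : ℝ) : EReal)) atTop
      ≤ ((2 - 1 / (p : ℝ) ^ h : ℝ) : EReal) ∧
    (p ^ h ≤ 17 →
      ∃ R : ℝ, (∀ x : ℝ, (0 < x ∧ x < 1 - 1 / (p : ℝ) ^ h ∧ mrrw (p ^ h) x = x) ↔ x = R) ∧
        limsup (fun r : ℕ => (((scalarDavenport (φ r) 2 : ℝ) / (r : ℝ) : ℝ) : EReal)) atTop
          ≤ ((1 / (1 - R) : ℝ) : EReal) ∧
        tableBound (p ^ h) - 1 / 10 ^ 4 < 1 / (1 - R) ∧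
        1 / (1 - R) ≤ tableBound (p ^ h) ∧
        tableBound (p ^ h) < 2 - 1 / (p : ℝ) ^ h) := by
  have : Finite F := Nat.finite_of_card_ne_zero (by rw [hF]; exact (pow_pos hp.pos h).ne')
  let _ : Fintype F := Fintype.ofFinite F
  have hcard : Fintype.card F = p ^ h := by rw [← hF, Nat.card_eq_fintype_card]
  have hcast : (p : ℝ) ^ h = ((Fintype.card F : ℕ) : ℝ) := by rw [hcard]; push_cast; rfl
  have hpow : IsPrimePow (Fintype.card F) := by
    rw [hcard]
    exact hp.isPrimePow.pow (by omega)
  rw [hcast, ← hcard]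
  refine ⟨limsup_scalarDavenport_le_plotkin φ, fun h17 => ?_⟩
  have hq := hpow.two_le
  obtain ⟨R, hR0, hR1, hR⟩ := exists_mrrw_eq_self hq
  have hRI : R ∈ Set.Icc 0 (1 - 1 / (Fintype.card F : ℝ)) := ⟨hR0.le, hR1.le⟩
  refine ⟨R, fun x => ⟨fun ⟨hx0, hx1, hx⟩ => ?_, ?_⟩,
    limsup_scalarDavenport_le_mrrw φ hR0 hR1 hR, tableBound_bracket hpow h17 hRI hR⟩
  · exact eq_of_mrrw_eq_self hq ⟨hx0.le, hx1.le⟩ hRI hx hR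
  · rintro rfl
    exact ⟨hR0, hR1, hR⟩
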